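/- Let $D$ be a finite non-empty set, $k$ a kernel on $D$ with $k(x,x)=1$, $\sigma^2:D\to(0,\infty)$ a noise variance function and $c:D\to(0,\infty)$ a cost function, with $c_{\min}=\min_x c(x)$, $c_{\max}=\max_x c(x)$. Let $f$ be a centred Gaussian process on $D$ with covariance function $k$. Querying $x_t$ at time $t=1,2,\dots$ returns $y_t=f(x_t)+z_t$ with independent noise $z_t\sim N(0,\sigma^2(x_t))$. Write $\mu_t$ and $\sigma_t^2$ for the Gaussian posterior mean and variance of $f$ given $x_1,y_1,\dots,x_t,y_t$, that is, $$\mu_t(x)=k_t(x)^T(K_t+\Sigma_t)^{-1}y_{1:t},\qquad \sigma_t^2(x)=k(x,x)-k_t(x)^T(K_t+\Sigma_t)^{-1}k_t(x),$$ where $k_t(x)=[k(x_i,x)]_{i\le t}$, $K_t=[k(x_i,x_j)]_{i,j\le t}$, $\Sigma_t=\mathrm{diag}(\sigma^2(x_1),\dots,\sigma^2(x_t))$. For a finite collection $S$ of points (duplicates allowed) let $\sigma^2_{t|S}$ be the posterior variance after additionally observing at the points of $S$, and let $c(S)$ be the sum of the costs of the points of $S$. **Algorithm (TruVaR).** The task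 is either Bayesian optimization (BO) or level-set estimation (LSE) with threshold $h\in\mathbb R$. The parameters are $\bar\delta>0$, $r\in(0,1)$, $\eta_{(1)}>0$ and a non-decreasing deterministic sequence $(\beta_{(i)})_{i\ge1}$; put $\eta_{(i)}=\eta_{(1)}r^{i-1}$. Start with $M_0=D$, $H_0=L_0=\emptyset$ and epoch $i=1$. At time $t$, query a point $x_t$ that maximizes over $x\in D$ $$\frac{\sum_{\bar x\in M_{t-1}}\max\{\beta_{(i)}\sigma_{t-1}^2(\bar x),\eta_{(i)}^2\}-\sum_{\bar x\in M_{t-1}}\max\{\beta_{(i)}\sigma_{t-1|\{x\}}^2(\bar x),\eta_{(i)}^2\}}{c(x)}$$ (ties are broken arbitrarily, depending only on past observations and possibly on independent randomness), observe $y_t$, and put $u_t=\mu_t+\beta_{(i)}^{1/2}\sigma_t$, $\ell_t=\mu_t-\beta_{(i)}^{1/2}\sigma_t$. For BO, set $M_t=\{x\in M_{t-1}:u_t(x)\ge\max_{\bar x\in M_{t-1}}\ell_t(\bar x)\}$. For LSE, set $M_t=\{x\in M_{t-1}:u_t(x)\ge h,\ \ell_t(x)\le h\}$, $H_t=H_{t-1}\cup\{x\in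 M_{t-1}:\ell_t(x)>h\}$ and $L_t=L_{t-1}\cup\{x\in M_{t-1}:u_t(x)<h\}$. Then, while $\beta_{(i)}^{1/2}\sigma_t(x)\le(1+\bar\delta)\eta_{(i)}$ for all $x\in M_t$, increase $i$ by one (if $M_t=\emptyset$, all points are classified, the sets no longer change, and $i$ is left unchanged). **$\epsilon$-accuracy at time $t$.** For BO: $M_t$ contains all maximizers of $f$, and $\max f-f(x)\le\epsilon$ for all $x\in M_t$. For LSE: $f>h$ on $H_t$, $f<h$ on $L_t$, and $|f-h|\le\epsilon/2$ on $M_t$. **Further notation.** $C^*(\xi,M)=\min\{c(S):\max_{\bar x\in M}\sigma_{0|S}(\bar x)\le\xi\}$. Let $\overline M_{(0)}=D$ and, for $i\ge1$, $\overline M_{(i)}=\{x:f(x)\ge\max f-4(1+\bar\delta)\eta_{(i)}\}$ (BO) or $\overline M_{(i)}=\{x:|f(x)-h|\le2(1+\bar\delta)\eta_{(i)}\}$ (LSE). **Theorem.** Assume that for all $t$, all selected points $x_1,\dots,x_t$ and all $x\in D$ the variance reduction $S\mapsto\sigma_t^2(x)-\sigma_{t|S}^2(x)$ is submodular. Let $\epsilon>0$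 and $\delta\in(0,1)$. Then there is an event of probability at least $1-\delta$ on which the following holds. For all real budgets $(C_{(i)})_{i\ge1}$ such that, for every $i\ge1$, $C_{(i)}\ge c_{\max}$, $$C_{(i)}\ge C^*\Big(\frac{\eta_{(i)}}{\beta_{(i)}^{1/2}},\overline M_{(i-1)}\Big)\log\frac{|\overline M_{(i-1)}|\,\beta_{(i)}}{\bar\delta^2\eta_{(i)}^2}+c_{\max} \quad\text{and}\quad \beta_{(i)}\ge2\log\frac{|D|\big(\sum_{i'\le i}C_{(i')}\big)^2\pi^2}{6\delta c_{\min}^2}$$ (where the first term of the middle condition is read as $0$ if $\overline M_{(i-1)}=\emptyset$), TruVaR is $\epsilon$-accurate at every time $t$ at which the cumulative cost $\sum_{t'\le t}c(x_{t'})$ is at least $$C_\epsilon=C_{(1)}+\sum_{i\ge2\,:\,4(1+\bar\delta)\eta_{(i-1)}>\epsilon}C_{(i)}.$$ -/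

import Mathlib

open MeasureTheory ProbabilityTheory

noncomputable section

namespace TruVaR

/-- The two problems: Bayesian optimization, and level-set estimation with threshold `h`. -/
inductive Task where
  | bo : Task
  | lse (h : ℝ) : Task

/-- The data of a problem instance and the parameters of the algorithm. -/
structure Params (D : Type*) where
  /-- Bayesian optimization or level-set estimation -/
  task : Task
  /-- kernel (prior covariance function) -/
  k : D → D → ℝ
  /-- noise variance at a point -/
  noise : D → ℝ
  /-- cost of querying a point -/
  c : D → ℝ
  /-- confidence parameters, one per epoch; epochs are numbered from 1 -/
  β : ℕ → ℝ
  /-- slack in the target confidence -/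
  δbar : ℝ
  /-- reduction factor of the target confidence -/
  r : ℝ
  /-- target confidence of the first epoch -/
  η₁ : ℝ

section Posterior

variable {D : Type*}

/-- The covariance matrix of the observations at `p 0, …, p (n - 1)`: kernel plus noise. -/
def obsCov (P : Params D) {n : ℕ} (p : Fin n → D) : Matrix (Fin n) (Fin n) ℝ :=
  Matrix.of (fun i j => P.k (p i) (p j)) + Matrix.diagonal (fun i => P.noise (p i))

/-- Posterior mean at `x` after observing the value `y j` at `p j` for every `j`. -/
def postMean (P : Params D) {n : ℕ} (p : Fin n → D) (y : Fin n → ℝ) (x : D) : ℝ :=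
  (fun i => P.k (p i) x) ⬝ᵥ Matrix.mulVec (obsCov P p)⁻¹ y

/-- Posterior variance at `x` after observing at the points `p 0, …, p (n - 1)`. -/
def postVar (P : Params D) {n : ℕ} (p : Fin n → D) (x : D) : ℝ :=
  P.k x x - (fun i => P.k (p i) x) ⬝ᵥ Matrix.mulVec (obsCov P p)⁻¹ (fun i => P.k (p i) x)

/-- Posterior standard deviation. -/
def postSd (P : Params D) {n : ℕ} (p : Fin n → D) (x : D) : ℝ :=
  Real.sqrt (postVar P p x)

/-- The reduction of the posterior variance at `x` achieved by observing the additional points `S`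
after the points `p`. -/
def varReduction (P : Params D) {t n : ℕ} (p : Fin t → D) (x : D) (S : Fin n → D) : ℝ :=
  postVar P p x - postVar P (Fin.append p S) x

/-- Submodularity of the variance reduction, as a function of the collection `S` of additional
points (which may contain duplicates): for all previously selected points `p` and all query points
`x`, the gain of adding a point `a` to `S` is at least the gain of adding `a` to a larger
collection, consisting of `S` and `U`. -/
def SubmodularVarReduction (P : Params D) : Prop :=
  ∀ (t n m : ℕ) (p : Fin t → D) (x : D) (S : Fin n → D) (U : Fin m → D) (a : D),
    varReduction P p x (Fin.append (Fin.append S U) ![a])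
        - varReduction P p x (Fin.append S U)
      ≤ varReduction P p x (Fin.append S ![a]) - varReduction P p x S

/-- `C*(ξ, M)`: the minimum cost of a collection of points (duplicates allowed) that brings the
posterior standard deviation down to at most `ξ` everywhere in `M`. -/
def minCost (P : Params D) (ξ : ℝ) (M : Finset D) : ℝ :=
  sInf {C : ℝ | ∃ (n : ℕ) (S : Fin n → D),
    (∀ x ∈ M, postSd P S x ≤ ξ) ∧ C = ∑ j, P.c (S j)}

end Posterior

/-- The target confidence `η_(i) = η_(1) r ^ (i - 1)` of epoch `i ≥ 1`. -/
def Params.η {D : Type*} (P : Params D) (i : ℕ) : ℝ :=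
  P.η₁ * P.r ^ (i - 1)

section Algorithm

variable {D : Type*} [Fintype D] [DecidableEq D]

/-- The state after some number of queries: the unclassified points `M`, the points `H` and `L`
classified as above and below the threshold (level-set estimation only), and the epoch number. -/
structure State (D : Type*) where
  M : Finset D
  H : Finset D
  L : Finset D
  epoch : ℕ

open Classical in
/-- The loop that advances the epoch number `i` as long as
`β_(i) ^ (1/2) σ(x) ≤ (1 + δbar) η_(i)` for all `x ∈ M`, where `σ` is the posterior standard
deviation given the points `p`. If it would never stop (which happens when `M` is empty, that is,
when every point is classified), then the epoch number is left unchanged. -/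
def nextEpoch (P : Params D) {n : ℕ} (p : Fin n → D) (M : Finset D) (i : ℕ) : ℕ :=
  if h : ∃ j, i ≤ j ∧ ¬ ∀ x ∈ M, Real.sqrt (P.β j) * postSd P p x ≤ (1 + P.δbar) * P.η j
  then Nat.find h else i

/-- Upper confidence bound of epoch `i`. -/
def ucb (P : Params D) (i : ℕ) {n : ℕ} (p : Fin n → D) (y : Fin n → ℝ) (x : D) : ℝ :=
  postMean P p y x + Real.sqrt (P.β i) * postSd P p x

/-- Lower confidence bound of epoch `i`. -/
def lcb (P : Params D) (i : ℕ) {n : ℕ} (p : Fin n → D) (y : Fin n → ℝ) (x : D) : ℝ :=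
  postMean P p y x - Real.sqrt (P.β i) * postSd P p x

open Classical in
/-- The update of the state `s` once all points queried so far are `p`, with observations `y`. -/
def update (P : Params D) (s : State D) {n : ℕ} (p : Fin n → D) (y : Fin n → ℝ) : State D :=
  let u := ucb P s.epoch p y
  let l := lcb P s.epoch p y
  match P.task with
  | Task.bo =>
      let M' := s.M.filter (fun x => ∀ z ∈ s.M, l z ≤ u x)
      { M := M', H := s.H, L := s.L, epoch := nextEpoch P p M' s.epoch }
  | Task.lse h =>
      let M' := s.M.filter (fun x => h ≤ u x ∧ l x ≤ h)
      { M := M'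
        H := s.H ∪ s.M.filter (fun x => h < l x)
        L := s.L ∪ s.M.filter (fun x => u x < h)
        epoch := nextEpoch P p M' s.epoch }

/-- The state after `t` queries, when the queried points are `x 0, x 1, …` and the observations
are `y 0, y 1, …` (the query with index `j` is the one of time step `j + 1`). -/
def state (P : Params D) (x : ℕ → D) (y : ℕ → ℝ) : ℕ → State D
  | 0 => { M := Finset.univ, H := ∅, L := ∅, epoch := 1 }
  | t + 1 => update P (state P x y t) (fun j : Fin (t + 1) => x j) (fun j : Fin (t + 1) => y j)

/-- The acquisition function: truncated variance reduction per unit cost from querying `x` in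
addition to the points `p`. -/
def acq (P : Params D) (s : State D) {n : ℕ} (p : Fin n → D) (x : D) : ℝ :=
  (∑ z ∈ s.M, max (P.β s.epoch * postVar P p z) (P.η s.epoch ^ 2)
    - ∑ z ∈ s.M, max (P.β s.epoch * postVar P (Fin.append p ![x]) z) (P.η s.epoch ^ 2)) / P.c x

/-- Every query maximizes the acquisition function; ties may be broken in any way. -/
def IsRun (P : Params D) (x : ℕ → D) (y : ℕ → ℝ) : Prop :=
  ∀ (t : ℕ) (z : D),
    acq P (state P x y t) (fun j : Fin t => x j) z
      ≤ acq P (state P x y t) (fun j : Fin t => x j) (x t)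

/-- `ε`-accuracy of a state with respect to the reward function `f`. -/
def Accurate (P : Params D) (ε : ℝ) (f : D → ℝ) (s : State D) : Prop :=
  match P.task with
  | Task.bo => ∀ xs, (∀ z, f z ≤ f xs) → xs ∈ s.M ∧ ∀ x ∈ s.M, f xs - f x ≤ ε
  | Task.lse h =>
      (∀ x ∈ s.H, h < f x) ∧ (∀ x ∈ s.L, f x < h) ∧ ∀ x ∈ s.M, |f x - h| ≤ ε / 2

open Classical in
/-- The sets `Mbar_(i)`: everything for `i = 0`, and for `i ≥ 1` the points whose value is within
`4 (1 + δbar) η_(i)` of the maximum, respectively within `2 (1 + δbar) η_(i)` of the threshold. -/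
def Mbar (P : Params D) (f : D → ℝ) (i : ℕ) : Finset D :=
  if i = 0 then Finset.univ else
    match P.task with
    | Task.bo => Finset.univ.filter (fun x => (⨆ z, f z) - 4 * (1 + P.δbar) * P.η i ≤ f x)
    | Task.lse h => Finset.univ.filter (fun x => |f x - h| ≤ 2 * (1 + P.δbar) * P.η i)

/-- The conditions on the epoch budgets `C` (and on the confidence parameters) for the reward
function `f`. The condition `⨆ x, P.c x ≤ C i` follows from the one after it unless the logarithm
is negative. -/
def ValidBudgets (P : Params D) (δ : ℝ) (f : D → ℝ) (C : ℕ → ℝ) : Prop :=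
  ∀ i, 1 ≤ i →
    (⨆ x, P.c x) ≤ C i ∧
    minCost P (P.η i / Real.sqrt (P.β i)) (Mbar P f (i - 1))
        * Real.log ((Mbar P f (i - 1)).card * P.β i / (P.δbar ^ 2 * P.η i ^ 2))
      + (⨆ x, P.c x) ≤ C i ∧
    2 * Real.log ((Fintype.card D : ℝ) * (∑ j ∈ Finset.Icc 1 i, C j) ^ 2 * Real.pi ^ 2
        / (6 * δ * (⨅ x, P.c x) ^ 2)) ≤ P.β i

/-- The epochs that count towards accuracy `ε`: the first one, and every epoch `i` such that
`4 (1 + δbar) η_(i-1) > ε`. -/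
def epochsBefore (P : Params D) (ε : ℝ) : Set ℕ :=
  {i | 1 ≤ i ∧ (i = 1 ∨ ε < 4 * (1 + P.δbar) * P.η (i - 1))}

end Algorithm
end TruVaR

end

/-!
The proof splits into a probabilistic and a deterministic part, which meet in `ConfidenceBounds`:
at every time `t ≥ 1` and every point, `f` differs from the posterior mean by at most
`√(2 log (|D| t² π² / (6 δ)))` posterior standard deviations.

*Probability* (`IsModel.exists_confidenceBounds`). The confidence bounds do not mention the budgets,
so that one event serves all of them. At fixed query points `p` the prediction error is Gaussian
with variance `postVar P p`, and independent of the observations, being uncorrelated with them. Adaptive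
queries are reduced to this case without conditional distributions: on the event that the queried
points are `p`, the observations are those at the fixed points `p`, and this event is determined by
them and the seed, of which the prediction error for `p` is independent. Summing over the finitely
many `p` gives the Gaussian tail bound for the adaptive queries, and the union bound over all times
and points costs `δ` because `∑ 1 / t ^ 2 = π ^ 2 / 6`. The constant in
`gaussianReal_abs_gt_le` has to be `1`; the Chernoff bound would lose a factor of two.

*Greedy covering* (`excess_append_le`). The posterior variance is the least error of a linear
predictor, hence it decreases with further observations. During an epoch, the acquisition
function greedily reduces `excess`, the amount by which the scaled variances exceed the target. By
submodularity, a collection of points of cost `T` that meets the target contains a point whose gain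
per unit cost is at least `excess / T`, so that queries of cost `A` shrink the excess by a factor
`exp (-A / T)`. While the epoch lasts, the excess is more than `δbar² η²`, which bounds `A` by
`T log (|Mbar| β / (δbar² η²))`; the query that ends the epoch costs at most the maximum cost.
Together this is at most the budget of the epoch (`Invariant.cost_add_le`).

*Induction over time* (`Invariant.succ`). Since the epochs so far have stayed within their budgets,
`t` is at most the sum of these budgets divided by the minimum cost, so that the confidence
parameter of the current epoch is large enough for the confidence bounds at time `t`. Hence all
classifications are correct, and when an epoch has reached its target, the remaining points lie in
the set `Mbar` of that epoch, which is the set to be covered in the next one. Once the cost has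
reached the sum of the budgets of the epochs that count towards accuracy `ε`, these epochs are over
or no points remain.
-/

noncomputable section

namespace TruVaR

/-! ### Posterior variance as a least squares error -/

section PosteriorVariance

variable {D : Type*}

/-- The kernel is a covariance function and the noise is non-degenerate: all that the algebraic
properties of the posterior variance need. -/
structure IsCovariance (P : Params D) : Prop where
  symm : ∀ x z, P.k x z = P.k z x
  psd : ∀ (n : ℕ) (p : Fin n → D) (a : Fin n → ℝ),
    0 ≤ ∑ i, ∑ j, a i * a j * P.k (p i) (p j)
  noise_pos : ∀ x, 0 < P.noise x

/-- The mean squared error of the linear predictor of `f x` which weights the observations at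
`p` by `a`. -/
def linErr (P : Params D) {n : ℕ} (p : Fin n → D) (a : Fin n → ℝ) (x : D) : ℝ :=
  P.k x x - 2 * (a ⬝ᵥ fun i => P.k (p i) x) + a ⬝ᵥ (obsCov P p).mulVec a

/-- The weights of the best linear predictor of `f x` from the observations at `p`. -/
def weights (P : Params D) {n : ℕ} (p : Fin n → D) (x : D) : Fin n → ℝ :=
  (obsCov P p)⁻¹.mulVec fun i => P.k (p i) x

lemma dotProduct_obsCov_mulVec (P : Params D) {n : ℕ} (p : Fin n → D) (a : Fin n → ℝ) :
    a ⬝ᵥ (obsCov P p).mulVec a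
      = ∑ i, ∑ j, a i * a j * P.k (p i) (p j) + ∑ i, a i ^ 2 * P.noise (p i) := by
  simp only [obsCov, Matrix.add_mulVec, dotProduct_add]
  congr 1
  · simp only [dotProduct, Matrix.mulVec, Matrix.of_apply, Finset.mul_sum]
    exact Finset.sum_congr rfl fun i _ => Finset.sum_congr rfl fun j _ => by ring
  · simp only [dotProduct, Matrix.mulVec_diagonal]
    exact Finset.sum_congr rfl fun i _ => by ring

lemma sum_sq_mul_noise_pos {P : Params D} (hP : IsCovariance P) {n : ℕ} (p : Fin n → D)
    {a : Fin n → ℝ} (ha : a ≠ 0) : 0 < ∑ i, a i ^ 2 * P.noise (p i) := by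
  obtain ⟨i, hi⟩ := Function.ne_iff.mp ha
  refine Finset.sum_pos' (fun j _ => ?_) ⟨i, Finset.mem_univ _, ?_⟩
  · have := hP.noise_pos (p j)
    positivity
  · have := hP.noise_pos (p i)
    have : a i ≠ 0 := hi
    positivity

lemma posDef_obsCov {P : Params D} (hP : IsCovariance P) {n : ℕ} (p : Fin n → D) :
    (obsCov P p).PosDef := by
  refine Matrix.posDef_iff_dotProduct_mulVec.mpr ⟨?_, fun {a} ha => ?_⟩
  · ext i j
    by_cases hij : i = j
    · subst hij; simp [obsCov]
    · simp [obsCov, hij, Ne.symm hij, hP.symm (p i) (p j)]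
  · rw [star_trivial, dotProduct_obsCov_mulVec]
    exact add_pos_of_nonneg_of_pos (hP.psd n p a) (sum_sq_mul_noise_pos hP p ha)

lemma obsCov_mulVec_weights {P : Params D} (hP : IsCovariance P) {n : ℕ} (p : Fin n → D) (x : D) :
    (obsCov P p).mulVec (weights P p x) = fun i => P.k (p i) x := by
  have h := (Matrix.isUnit_iff_isUnit_det _).mp (posDef_obsCov hP p).isUnit
  rw [weights, Matrix.mulVec_mulVec, Matrix.mul_nonsing_inv _ h, Matrix.one_mulVec]

lemma transpose_obsCov {P : Params D} (hP : IsCovariance P) {n : ℕ} (p : Fin n → D) :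
    (obsCov P p).transpose = obsCov P p := by
  have := (posDef_obsCov hP p).isHermitian
  rwa [Matrix.IsHermitian, Matrix.conjTranspose_eq_transpose_of_trivial] at this

lemma dotProduct_obsCov_mulVec_comm {P : Params D} (hP : IsCovariance P) {n : ℕ} (p : Fin n → D)
    (a b : Fin n → ℝ) : a ⬝ᵥ (obsCov P p).mulVec b = b ⬝ᵥ (obsCov P p).mulVec a := by
  rw [Matrix.dotProduct_mulVec, ← Matrix.mulVec_transpose, transpose_obsCov hP, dotProduct_comm]

lemma postVar_eq (P : Params D) {n : ℕ} (p : Fin n → D) (x : D) :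
    postVar P p x = P.k x x - weights P p x ⬝ᵥ fun i => P.k (p i) x := by
  rw [postVar, weights, dotProduct_comm]

lemma postMean_eq {P : Params D} (hP : IsCovariance P) {n : ℕ} (p : Fin n → D) (y : Fin n → ℝ)
    (x : D) : postMean P p y x = weights P p x ⬝ᵥ y := by
  rw [postMean, weights, Matrix.dotProduct_mulVec, ← Matrix.mulVec_transpose,
    Matrix.transpose_nonsing_inv, transpose_obsCov hP]

lemma linErr_eq {P : Params D} (hP : IsCovariance P) {n : ℕ} (p : Fin n → D) (a : Fin n → ℝ)
    (x : D) : linErr P p a x = postVar P p x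
      + (a - weights P p x) ⬝ᵥ (obsCov P p).mulVec (a - weights P p x) := by
  rw [Matrix.mulVec_sub, sub_dotProduct, dotProduct_sub, dotProduct_sub,
    dotProduct_obsCov_mulVec_comm hP p (weights P p x) a, obsCov_mulVec_weights hP, linErr,
    postVar_eq]
  ring

lemma linErr_weights {P : Params D} (hP : IsCovariance P) {n : ℕ} (p : Fin n → D) (x : D) :
    linErr P p (weights P p x) x = postVar P p x := by
  simp [linErr_eq hP]

lemma postVar_le_linErr {P : Params D} (hP : IsCovariance P) {n : ℕ} (p : Fin n → D)
    (a : Fin n → ℝ) (x : D) : postVar P p x ≤ linErr P p a x := by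
  rw [linErr_eq hP]
  have := (posDef_obsCov hP p).posSemidef.dotProduct_mulVec_nonneg (a - weights P p x)
  rw [star_trivial] at this
  linarith

lemma postVar_le {P : Params D} (hP : IsCovariance P) {n : ℕ} (p : Fin n → D) (x : D) :
    postVar P p x ≤ P.k x x := by
  simpa [linErr] using postVar_le_linErr hP p 0 x

lemma sum_extend_mul {m n : ℕ} {e : Fin m → Fin n} (he : Function.Injective e) (a : Fin m → ℝ)
    (F : Fin n → ℝ) : Function.extend e a 0 ⬝ᵥ F = ∑ i, a i * F (e i) := by
  classical
  simp only [dotProduct]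
  rw [← Finset.sum_subset (Finset.subset_univ (Finset.univ.image e)),
    Finset.sum_image he.injOn]
  · simp [he.extend_apply]
  · intro j _ hj
    rw [Function.extend_apply']
    · simp
    · rintro ⟨i, rfl⟩
      exact hj (Finset.mem_image_of_mem _ (Finset.mem_univ _))

/-- Further observations do not increase the posterior variance: a predictor can ignore them. -/
lemma postVar_le_of_injective {P : Params D} (hP : IsCovariance P) {m n : ℕ} {p : Fin m → D}
    {q : Fin n → D} {e : Fin m → Fin n} (he : Function.Injective e) (hpq : ∀ i, q (e i) = p i)
    (x : D) : postVar P q x ≤ postVar P p x := by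
  refine (postVar_le_linErr hP q (Function.extend e (weights P p x) 0) x).trans_eq ?_
  rw [← linErr_weights hP p]
  simp only [linErr, sum_extend_mul he, hpq]
  congr 1
  refine Finset.sum_congr rfl fun i _ => ?_
  congr 1
  simp only [Matrix.mulVec]
  rw [dotProduct_comm, sum_extend_mul he, dotProduct_comm]
  refine Finset.sum_congr rfl fun j _ => ?_
  simp [obsCov, Matrix.diagonal_apply, he.eq_iff, hpq]

lemma postVar_append_le_left {P : Params D} (hP : IsCovariance P) {m n : ℕ} (p : Fin m → D)
    (q : Fin n → D) (x : D) : postVar P (Fin.append p q) x ≤ postVar P p x :=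
  postVar_le_of_injective hP (Fin.castAdd_injective m n) (by simp) x

lemma postVar_append_le_right {P : Params D} (hP : IsCovariance P) {m n : ℕ} (p : Fin m → D)
    (q : Fin n → D) (x : D) : postVar P (Fin.append p q) x ≤ postVar P q x :=
  postVar_le_of_injective hP (Fin.natAdd_injective n m) (by simp) x

lemma varReduction_nonneg {P : Params D} (hP : IsCovariance P) {m n : ℕ} (p : Fin m → D) (x : D)
    (S : Fin n → D) : 0 ≤ varReduction P p x S :=
  sub_nonneg.mpr (postVar_append_le_left hP p S x)

/-- The noise part of the error of the best predictor bounds the posterior variance from below. -/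
lemma sum_weights_sq_mul_noise_le_postVar {P : Params D} (hP : IsCovariance P) {n : ℕ}
    (p : Fin n → D) (x : D) : ∑ i, weights P p x i ^ 2 * P.noise (p i) ≤ postVar P p x := by
  -- the noise-free part of the error is the quadratic form of the kernel at the points `x, p`
  have h := hP.psd (n + 1) (Fin.cons x p) (Fin.cons 1 (-weights P p x))
  rw [← linErr_weights hP, linErr, dotProduct_obsCov_mulVec, dotProduct]
  simp only [Fin.sum_univ_succ, Fin.cons_zero, Fin.cons_succ, Pi.neg_apply, one_mul, mul_one,
    neg_mul, mul_neg, Finset.sum_add_distrib, Finset.sum_neg_distrib] at h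
  simp only [hP.symm x] at h
  linarith

lemma postVar_nonneg {P : Params D} (hP : IsCovariance P) {n : ℕ} (p : Fin n → D) (x : D) :
    0 ≤ postVar P p x :=
  (Finset.sum_nonneg fun _ _ => mul_nonneg (sq_nonneg _) (hP.noise_pos _).le).trans
    (sum_weights_sq_mul_noise_le_postVar hP p x)

/-- Since the noise is non-degenerate, finitely many observations leave some uncertainty. -/
lemma postVar_pos {P : Params D} (hP : IsCovariance P) {n : ℕ} (p : Fin n → D) (x : D)
    (hx : 0 < P.k x x) : 0 < postVar P p x := by
  by_cases hw : weights P p x = 0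
  · simpa [postVar_eq, hw] using hx
  · exact (sum_sq_mul_noise_pos hP p hw).trans_le (sum_weights_sq_mul_noise_le_postVar hP p x)

lemma postVar_const_le {P : Params D} (hP : IsCovariance P) {n : ℕ} (hn : n ≠ 0) (x : D) :
    postVar P (fun _ : Fin n => x) x ≤ P.noise x / n := by
  refine (postVar_le_linErr hP _ (fun _ => (n : ℝ)⁻¹) x).trans_eq ?_
  have : (n : ℝ) ≠ 0 := by exact_mod_cast hn
  rw [linErr, dotProduct_obsCov_mulVec, dotProduct]
  simp only [Finset.sum_const, Finset.card_univ, Fintype.card_fin, nsmul_eq_mul]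
  field_simp
  ring

/-- Enough observations at every point bring the posterior variance below any level. -/
lemma exists_postVar_le [Fintype D] {P : Params D} (hP : IsCovariance P) {v : ℝ} (hv : 0 < v) :
    ∃ (n : ℕ) (S : Fin n → D), ∀ x, postVar P S x ≤ v := by
  obtain ⟨m, hm⟩ : ∃ m : ℕ, ∀ x, P.noise x / v ≤ m := by
    obtain ⟨b, hb⟩ := (Set.finite_range fun x => P.noise x / v).bddAbove
    obtain ⟨m, hm⟩ := exists_nat_ge b
    exact ⟨m, fun x => (hb ⟨x, rfl⟩).trans hm⟩
  let e := Fintype.equivFin (Fin m × D)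
  refine ⟨_, fun j => (e.symm j).2, fun x => ?_⟩
  have hm0 : (0 : ℝ) < m := lt_of_lt_of_le (div_pos (hP.noise_pos x) hv) (hm x)
  calc _ ≤ postVar P (fun _ : Fin m => x) x :=
        postVar_le_of_injective hP (e := fun i => e (i, x))
          (fun i j hij => by simpa using hij) (by simp) x
    _ ≤ P.noise x / m := postVar_const_le hP (by exact_mod_cast hm0.ne') x
    _ ≤ v := by
      rw [div_le_iff₀ hm0]
      have := (div_le_iff₀ hv).mp (hm x)
      linarith

lemma varReduction_comp_cast (P : Params D) {t m n : ℕ} (p : Fin t → D) (x : D) (S : Fin n → D)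
    (h : m = n) : varReduction P p x (S ∘ Fin.cast h) = varReduction P p x S := by
  subst h; rfl

/-- Submodularity makes the variance reduction subadditive. -/
lemma varReduction_le_sum {P : Params D} (hsub : SubmodularVarReduction P)
    {t : ℕ} (p : Fin t → D) (x : D) {n : ℕ} (S : Fin n → D) :
    varReduction P p x S ≤ ∑ j, varReduction P p x ![S j] := by
  have h0 : varReduction P p x ![] = 0 := by
    have : Fin.append p ![] = p := by simpa using Fin.append_right_nil p ![] rfl
    simp [varReduction, this]
  induction n with
  | zero => simp [Subsingleton.elim S ![], h0]
  | succ n ih =>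
    rw [Fin.sum_univ_castSucc]
    have h := hsub t 0 n p x ![] (Fin.init S) (S (Fin.last n))
    have e1 : Fin.append ![] (Fin.init S) = Fin.init S ∘ Fin.cast (Nat.zero_add n) :=
      Fin.append_left_nil _ _ rfl
    have e2 : Fin.append (Fin.append ![] (Fin.init S)) ![S (Fin.last n)]
        = S ∘ Fin.cast (by omega) := by
      rw [e1]
      ext i
      refine Fin.lastCases ?_ (fun i => ?_) i
      · have : (Fin.last (0 + n)) = Fin.natAdd (0 + n) (0 : Fin 1) := rfl
        rw [this, Fin.append_right]
        simp only [Matrix.cons_val_fin_one, Function.comp_apply]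
        congr 1
        ext; simp
      · have : i.castSucc = Fin.castAdd 1 i := rfl
        rw [this, Fin.append_left]
        rfl
    have e3 : Fin.append (![] : Fin 0 → D) ![S (Fin.last n)]
        = ![S (Fin.last n)] ∘ Fin.cast (Nat.zero_add 1) :=
      Fin.append_left_nil _ _ rfl
    rw [e2, e1, e3, varReduction_comp_cast, varReduction_comp_cast, varReduction_comp_cast, h0] at h
    have ih := ih (Fin.init S)
    simp only [Fin.init] at ih h
    linarith

end PosteriorVariance

/-! ### One greedy query -/

section Greedy

variable {D : Type*}

/-- The total excess of the scaled posterior variances over the target of epoch `i`, on `M`. -/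
def excess (P : Params D) (i : ℕ) (M : Finset D) {n : ℕ} (p : Fin n → D) : ℝ :=
  ∑ z ∈ M, (max (P.β i * postVar P p z) (P.η i ^ 2) - P.η i ^ 2)

lemma excess_mono (P : Params D) (i : ℕ) {M M' : Finset D} (h : M' ⊆ M) {n : ℕ} (p : Fin n → D) :
    excess P i M' p ≤ excess P i M p :=
  Finset.sum_le_sum_of_subset_of_nonneg h fun _ _ _ => sub_nonneg.mpr (le_max_right _ _)

lemma excess_nonneg (P : Params D) (i : ℕ) (M : Finset D) {n : ℕ} (p : Fin n → D) :
    0 ≤ excess P i M p :=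
  Finset.sum_nonneg fun _ _ => sub_nonneg.mpr (le_max_right _ _)

lemma excess_le_card_mul {P : Params D} (hP : IsCovariance P) (hk : ∀ x, P.k x x = 1) {i : ℕ}
    (hβ : 0 ≤ P.β i) (M : Finset D) {n : ℕ} (p : Fin n → D) :
    excess P i M p ≤ M.card * P.β i := by
  rw [← nsmul_eq_mul]
  refine Finset.sum_le_card_nsmul _ _ _ fun z _ => ?_
  have h1 : P.β i * postVar P p z ≤ P.β i :=
    mul_le_of_le_one_right hβ ((postVar_le hP p z).trans_eq (hk z))
  rw [sub_le_iff_le_add]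
  exact max_le (by nlinarith [sq_nonneg (P.η i)]) (by linarith)

/-- The acquisition function without the division by the cost. -/
def gain (P : Params D) (i : ℕ) (M : Finset D) {n : ℕ} (p : Fin n → D) (x : D) : ℝ :=
  ∑ z ∈ M, max (P.β i * postVar P p z) (P.η i ^ 2)
    - ∑ z ∈ M, max (P.β i * postVar P (Fin.append p ![x]) z) (P.η i ^ 2)

lemma gain_nonneg {P : Params D} (hP : IsCovariance P) {i : ℕ} (hβ : 0 ≤ P.β i) (M : Finset D)
    {n : ℕ} (p : Fin n → D) (x : D) : 0 ≤ gain P i M p x :=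
  sub_nonneg.mpr <| Finset.sum_le_sum fun z _ => max_le_max_right _ <|
    mul_le_mul_of_nonneg_left (postVar_append_le_left hP p _ z) hβ

lemma excess_append (P : Params D) (i : ℕ) (M : Finset D) {n : ℕ} (p : Fin n → D) (x : D) :
    excess P i M (Fin.append p ![x]) = excess P i M p - gain P i M p x := by
  simp only [excess, gain, Finset.sum_sub_distrib]
  ring

lemma min_sum_le_sum_min {ι : Type*} (s : Finset ι) (a : ι → ℝ) {K : ℝ} (ha : ∀ i ∈ s, 0 ≤ a i)
    (hK : 0 ≤ K) : min (∑ i ∈ s, a i) K ≤ ∑ i ∈ s, min (a i) K := by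
  by_cases h : ∃ i ∈ s, K ≤ a i
  · obtain ⟨i, hi, hKi⟩ := h
    calc _ ≤ K := min_le_right _ _
      _ = min (a i) K := (min_eq_right hKi).symm
      _ ≤ _ := Finset.single_le_sum (f := fun i => min (a i) K)
        (fun j hj => le_min (ha j hj) hK) hi
  · push Not at h
    refine (min_le_left _ _).trans (Finset.sum_le_sum fun i hi => ?_)
    exact le_min le_rfl (h i hi).le

/-- A collection of points which meets the target everywhere in `M` would remove the whole excess;
by submodularity its points, taken one at a time, achieve at least as much in total. -/
lemma excess_le_sum_gain {P : Params D} (hP : IsCovariance P) (hsub : SubmodularVarReduction P)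
    {i : ℕ} (hβ : 0 ≤ P.β i) (M : Finset D) {t n : ℕ} (p : Fin t → D) (S : Fin n → D)
    (hS : ∀ z ∈ M, P.β i * postVar P S z ≤ P.η i ^ 2) :
    excess P i M p ≤ ∑ j, gain P i M p (S j) := by
  simp only [gain, ← Finset.sum_sub_distrib, excess]
  rw [Finset.sum_comm]
  refine Finset.sum_le_sum fun z hz => ?_
  set e := P.η i ^ 2
  set v := P.β i * postVar P p z with hv
  -- the truncated reduction is the reduction, capped at the excess
  have key : ∀ w, 0 ≤ w → max v e - max (v - w) e = min w (max v e - e) := by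
    intro w h
    rcases le_total v e with h1 | h1
    · rw [max_eq_right h1, max_eq_right (by linarith)]
      simp [h]
    · rw [max_eq_left h1]
      rcases le_total (v - w) e with h2 | h2
      · rw [max_eq_right h2, min_eq_right (by linarith)]
      · rw [max_eq_left h2, min_eq_left (by linarith)]; ring
  have red : ∀ {m : ℕ} (T : Fin m → D),
      P.β i * postVar P (Fin.append p T) z = v - P.β i * varReduction P p z T := by
    intro m T
    rw [varReduction, hv]; ring
  have red0 : ∀ {m : ℕ} (T : Fin m → D), 0 ≤ P.β i * varReduction P p z T :=
    fun T => mul_nonneg hβ (varReduction_nonneg hP p z T)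
  have hK : 0 ≤ max v e - e := sub_nonneg.mpr (le_max_right _ _)
  calc max v e - e = min (P.β i * varReduction P p z S) (max v e - e) := by
        rw [← key _ (red0 S), ← red S,
          max_eq_right (a := P.β i * postVar P (Fin.append p S) z)]
        exact (mul_le_mul_of_nonneg_left (postVar_append_le_right hP p S z) hβ).trans (hS z hz)
    _ ≤ min (∑ j, P.β i * varReduction P p z ![S j]) (max v e - e) := by
        rw [← Finset.mul_sum]
        exact min_le_min_right _ (mul_le_mul_of_nonneg_left (varReduction_le_sum hsub p z S) hβ)
    _ ≤ ∑ j, min (P.β i * varReduction P p z ![S j]) (max v e - e) :=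
        min_sum_le_sum_min _ _ (fun j _ => red0 _) hK
    _ = _ := Finset.sum_congr rfl fun j _ => by
        rw [← key _ (red0 ![S j]), ← red]

/-- A query whose gain per unit cost is maximal achieves at least the share of the excess that
corresponds to its share of the cost of any collection of points which meets the target. -/
lemma excess_le_gain_div_mul {P : Params D} (hP : IsCovariance P)
    (hsub : SubmodularVarReduction P) (hc : ∀ x, 0 < P.c x) {i : ℕ} (hβ : 0 ≤ P.β i)
    (M : Finset D) {t n : ℕ} (p : Fin t → D) {x : D}
    (hx : ∀ z, gain P i M p z / P.c z ≤ gain P i M p x / P.c x) (S : Fin n → D)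
    (hS : ∀ z ∈ M, P.β i * postVar P S z ≤ P.η i ^ 2) :
    excess P i M p ≤ gain P i M p x / P.c x * ∑ j, P.c (S j) := by
  rw [Finset.mul_sum]
  refine (excess_le_sum_gain hP hsub hβ M p S hS).trans (Finset.sum_le_sum fun j _ => ?_)
  exact (div_le_iff₀ (hc _)).mp (hx (S j))

/-- A greedy query shrinks the excess by a factor that is exponential in its relative cost. -/
lemma excess_append_le {P : Params D} (hP : IsCovariance P)
    (hsub : SubmodularVarReduction P) (hc : ∀ x, 0 < P.c x) {i : ℕ} (hβ : 0 ≤ P.β i)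
    (M : Finset D) {t n : ℕ} (p : Fin t → D) {x : D}
    (hx : ∀ z, gain P i M p z / P.c z ≤ gain P i M p x / P.c x) (S : Fin n → D)
    (hS : ∀ z ∈ M, P.β i * postVar P S z ≤ P.η i ^ 2) :
    excess P i M (Fin.append p ![x]) * Real.exp (P.c x / ∑ j, P.c (S j)) ≤ excess P i M p := by
  have hg := gain_nonneg hP hβ M p x
  have he := excess_nonneg P i M p
  have h := excess_le_gain_div_mul hP hsub hc hβ M p hx S hS
  have hT : 0 ≤ ∑ j, P.c (S j) := Finset.sum_nonneg fun j _ => (hc _).le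
  have hcx := hc x
  set T := ∑ j, P.c (S j)
  rw [← le_div_iff₀ (Real.exp_pos _), div_eq_mul_inv, ← Real.exp_neg, excess_append]
  have h1 : excess P i M p * (P.c x / T) ≤ gain P i M p x := by
    rcases hT.eq_or_lt with hT | hT
    · simpa [← hT] using hg
    · rw [mul_div_assoc', div_le_iff₀ hT]
      calc _ ≤ gain P i M p x / P.c x * T * P.c x := by gcongr
        _ = _ := by field_simp
  have h2 := mul_le_mul_of_nonneg_left (Real.add_one_le_exp (-(P.c x / T))) he
  linarith

end Greedy

/-! ### Costs, confidence parameters and epochs -/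

/-- The standing assumptions on the parameters of the algorithm. -/
structure Admissible {D : Type*} (P : Params D) : Prop where
  cov : IsCovariance P
  k_self : ∀ x, P.k x x = 1
  sub : SubmodularVarReduction P
  c_pos : ∀ x, 0 < P.c x
  β_le : ∀ i, 1 ≤ i → P.β i ≤ P.β (i + 1)
  δbar_pos : 0 < P.δbar
  r_pos : 0 < P.r
  r_lt_one : P.r < 1
  η₁_pos : 0 < P.η₁

section Basic

variable {D : Type*} {P : Params D}

lemma Admissible.η_pos (hP : Admissible P) (i : ℕ) : 0 < P.η i :=
  mul_pos hP.η₁_pos (pow_pos hP.r_pos _)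

lemma Admissible.η_anti (hP : Admissible P) {i j : ℕ} (h : i ≤ j) : P.η j ≤ P.η i :=
  mul_le_mul_of_nonneg_left (pow_le_pow_of_le_one hP.r_pos.le hP.r_lt_one.le (by omega))
    hP.η₁_pos.le

lemma Admissible.exists_η_lt (hP : Admissible P) {a : ℝ} (ha : 0 < a) (i : ℕ) :
    ∃ j, i ≤ j ∧ P.η j < a := by
  obtain ⟨n, hn⟩ := exists_pow_lt_of_lt_one (div_pos ha hP.η₁_pos) hP.r_lt_one
  refine ⟨max i (n + 1), le_max_left _ _, (hP.η_anti (le_max_right i (n + 1))).trans_lt ?_⟩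
  rw [lt_div_iff₀ hP.η₁_pos] at hn
  simpa [Params.η, mul_comm] using hn

lemma Admissible.β_mono (hP : Admissible P) {i j : ℕ} (hi : 1 ≤ i) (h : i ≤ j) :
    P.β i ≤ P.β j := by
  induction j, h using Nat.le_induction with
  | base => exact le_rfl
  | succ j hj ih => exact ih.trans (hP.β_le j (hi.trans hj))

lemma Admissible.postSd_pos (hP : Admissible P) {n : ℕ} (p : Fin n → D) (x : D) :
    0 < postSd P p x :=
  Real.sqrt_pos.mpr (postVar_pos hP.cov p x (by simp [hP.k_self]))

lemma sq_postSd (hP : IsCovariance P) {n : ℕ} (p : Fin n → D) (x : D) :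
    postSd P p x ^ 2 = postVar P p x :=
  Real.sq_sqrt (postVar_nonneg hP p x)

lemma Admissible.mul_postVar_le (hP : Admissible P) {i : ℕ} (hβ : 0 < P.β i) {n : ℕ}
    {S : Fin n → D} {z : D} (h : postSd P S z ≤ P.η i / √(P.β i)) :
    P.β i * postVar P S z ≤ P.η i ^ 2 := by
  have h1 := (le_div_iff₀ (Real.sqrt_pos.mpr hβ)).mp h
  have h2 := pow_le_pow_left₀ (mul_nonneg (hP.postSd_pos S z).le (Real.sqrt_nonneg _)) h1 2
  rw [mul_pow, sq_postSd hP.cov, Real.sq_sqrt hβ.le] at h2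
  linarith

/-- While the epoch has not reached its target, the excess is bounded away from zero. -/
lemma Admissible.lt_excess (hP : Admissible P) {i : ℕ} (hβ : 0 < P.β i) {M : Finset D} {n : ℕ}
    {p : Fin n → D} {z : D} (hz : z ∈ M) (h : (1 + P.δbar) * P.η i < √(P.β i) * postSd P p z) :
    P.δbar ^ 2 * P.η i ^ 2 < excess P i M p := by
  have hη := hP.η_pos i
  have hδ := hP.δbar_pos
  have h2 := pow_lt_pow_left₀ h (by positivity) two_ne_zero
  rw [mul_pow, mul_pow, sq_postSd hP.cov, Real.sq_sqrt hβ.le] at h2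
  calc P.δbar ^ 2 * P.η i ^ 2 < P.β i * postVar P p z - P.η i ^ 2 := by
        nlinarith [mul_pos hδ (pow_pos hη 2)]
    _ ≤ max (P.β i * postVar P p z) (P.η i ^ 2) - P.η i ^ 2 := by
        gcongr; exact le_max_left _ _
    _ ≤ excess P i M p := Finset.single_le_sum
        (f := fun z => max (P.β i * postVar P p z) (P.η i ^ 2) - P.η i ^ 2)
        (fun _ _ => sub_nonneg.mpr (le_max_right _ _)) hz

end Basic

section Budgets

variable {D : Type*} [Fintype D] {P : Params D} {δ : ℝ} {f : D → ℝ} {C : ℕ → ℝ}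

lemma le_iSup_cost (P : Params D) (x : D) : P.c x ≤ ⨆ z, P.c z :=
  le_ciSup (Set.finite_range _).bddAbove x

lemma iInf_cost_le (P : Params D) (x : D) : ⨅ z, P.c z ≤ P.c x :=
  ciInf_le (Set.finite_range _).bddBelow x

/-- A lower bound for the costs of all covering collections is one for `minCost`, because such
collections exist: the infimum is not that of the empty set. -/
lemma Admissible.le_minCost (hP : Admissible P) {ξ a : ℝ} (hξ : 0 < ξ) {M : Finset D}
    (h : ∀ (n : ℕ) (S : Fin n → D), (∀ x ∈ M, postSd P S x ≤ ξ) → a ≤ ∑ j, P.c (S j)) :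
    a ≤ minCost P ξ M := by
  obtain ⟨n, S, hS⟩ := exists_postVar_le hP.cov (pow_pos hξ 2)
  refine le_csInf ⟨_, n, S, fun x _ => Real.sqrt_le_iff.mpr ⟨hξ.le, hS x⟩, rfl⟩ ?_
  rintro _ ⟨n, S, hS, rfl⟩
  exact h n S hS

variable [Nonempty D]

lemma Admissible.iInf_cost_pos (hP : Admissible P) : 0 < ⨅ z, P.c z := by
  obtain ⟨x, hx⟩ := exists_eq_ciInf_of_finite (f := P.c)
  exact hx ▸ hP.c_pos x

lemma Admissible.iSup_cost_pos (hP : Admissible P) : 0 < ⨆ z, P.c z :=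
  (hP.c_pos (Classical.arbitrary D)).trans_le (le_iSup_cost P _)

lemma ValidBudgets.pos (hP : Admissible P) (hC : ValidBudgets P δ f C) {i : ℕ} (hi : 1 ≤ i) :
    0 < C i :=
  hP.iSup_cost_pos.trans_le (hC i hi).1

lemma ValidBudgets.sum_mono (hP : Admissible P) (hC : ValidBudgets P δ f C) {s t : Finset ℕ}
    (h : s ⊆ t) (ht : ∀ j ∈ t, 1 ≤ j) : ∑ j ∈ s, C j ≤ ∑ j ∈ t, C j :=
  Finset.sum_le_sum_of_subset_of_nonneg h fun j hj _ => (hC.pos hP (ht j hj)).le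

/-- The confidence parameter of an epoch is large enough for every time `t` at which the total
cost is still within the budgets of the epochs so far. -/
lemma ValidBudgets.two_mul_log_le (hP : Admissible P) (hC : ValidBudgets P δ f C) (hδ : 0 < δ)
    {i : ℕ} (hi : 1 ≤ i) {t : ℕ} (ht : 1 ≤ t)
    (h : t * (⨅ z, P.c z) ≤ ∑ j ∈ Finset.Icc 1 i, C j) :
    2 * Real.log ((Fintype.card D : ℝ) * t ^ 2 * Real.pi ^ 2 / (6 * δ)) ≤ P.β i := by
  have hc := hP.iInf_cost_pos
  have hcard : (0 : ℝ) < Fintype.card D := by exact_mod_cast Fintype.card_pos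
  have ht : (0 : ℝ) < t := by exact_mod_cast ht
  have hpi := Real.pi_pos
  refine le_trans ?_ (hC i hi).2.2
  refine mul_le_mul_of_nonneg_left (Real.log_le_log (by positivity) ?_) two_pos.le
  rw [div_le_div_iff₀ (by positivity) (by positivity)]
  have := pow_le_pow_left₀ (by positivity) h 2
  calc _ = (t * ⨅ z, P.c z) ^ 2 * (Fintype.card D * Real.pi ^ 2 * (6 * δ)) := by ring
    _ ≤ (∑ j ∈ Finset.Icc 1 i, C j) ^ 2 * (Fintype.card D * Real.pi ^ 2 * (6 * δ)) := by gcongr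
    _ = _ := by ring

lemma ValidBudgets.β_pos (hP : Admissible P) (hC : ValidBudgets P δ f C) (hδ : 0 < δ)
    (hδ' : δ < 1) {i : ℕ} (hi : 1 ≤ i) : 0 < P.β i := by
  refine lt_of_lt_of_le ?_ (hC.two_mul_log_le hP hδ hi le_rfl ?_)
  · have hcard : (1 : ℝ) ≤ Fintype.card D := by exact_mod_cast Fintype.card_pos
    have : (1 : ℝ) < Fintype.card D * ((1 : ℕ) : ℝ) ^ 2 * Real.pi ^ 2 / (6 * δ) := by
      rw [lt_div_iff₀ (by positivity)]
      have := Real.pi_gt_three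
      push_cast
      nlinarith
    have := Real.log_pos this
    linarith
  · have hx := Classical.arbitrary D
    calc ((1 : ℕ) : ℝ) * ⨅ z, P.c z = ⨅ z, P.c z := by simp
      _ ≤ ⨆ z, P.c z := (iInf_cost_le P hx).trans (le_iSup_cost P hx)
      _ ≤ C 1 := (hC 1 le_rfl).1
      _ = ∑ j ∈ {1}, C j := by simp
      _ ≤ ∑ j ∈ Finset.Icc 1 i, C j := hC.sum_mono hP (by simpa using hi) fun j hj =>
        (Finset.mem_Icc.mp hj).1

end Budgets

/-! ### Confidence bounds and costs along a sequence of queries -/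

section Sequence

variable {D : Type*} {P : Params D} {f : D → ℝ}

/-- The confidence bounds of epoch `i` hold everywhere. -/
def InBounds (P : Params D) (f : D → ℝ) (i : ℕ) {n : ℕ} (p : Fin n → D) (y : Fin n → ℝ) : Prop :=
  ∀ z, |f z - postMean P p y z| ≤ √(P.β i) * postSd P p z

lemma InBounds.le_ucb {i n : ℕ} {p : Fin n → D} {y : Fin n → ℝ} (h : InBounds P f i p y) (z : D) :
    f z ≤ ucb P i p y z := by
  have := (abs_le.mp (h z)).2
  rw [ucb]; linarith

lemma InBounds.lcb_le {i n : ℕ} {p : Fin n → D} {y : Fin n → ℝ} (h : InBounds P f i p y) (z : D) :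
    lcb P i p y z ≤ f z := by
  have := (abs_le.mp (h z)).1
  rw [lcb]; linarith

lemma ucb_sub_lcb (P : Params D) (i : ℕ) {n : ℕ} (p : Fin n → D) (y : Fin n → ℝ) (z : D) :
    ucb P i p y z - lcb P i p y z = 2 * (√(P.β i) * postSd P p z) := by
  rw [ucb, lcb]; ring

/-- The total cost of the first `t` queries. -/
def totalCost (P : Params D) (x : ℕ → D) (t : ℕ) : ℝ := ∑ j ∈ Finset.range t, P.c (x j)

lemma append_singleton (x : ℕ → D) (t : ℕ) :
    Fin.append (fun j : Fin t => x j) ![x t] = fun j : Fin (t + 1) => x j := by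
  ext i
  refine Fin.lastCases ?_ (fun i => ?_) i
  · have : Fin.last t = Fin.natAdd t (0 : Fin 1) := rfl
    rw [this, Fin.append_right]
    simp
  · have : i.castSucc = Fin.castAdd 1 i := rfl
    rw [this, Fin.append_left]
    rfl

/-- If no observations are needed to meet the target, then there is no excess. -/
lemma excess_eq_zero_of_empty (hP : IsCovariance P) {i : ℕ} (hβ : 0 < P.β i) {M : Finset D} {n : ℕ}
    {p : Fin n → D} {S : Fin 0 → D} (hS : ∀ z ∈ M, P.β i * postVar P S z ≤ P.η i ^ 2) :
    excess P i M p = 0 := by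
  refine Finset.sum_eq_zero fun z hz => ?_
  rw [sub_eq_zero, max_eq_right]
  refine (mul_le_mul_of_nonneg_left ?_ hβ.le).trans (hS z hz)
  exact postVar_le_of_injective hP (e := Fin.elim0) (fun i => i.elim0) (fun i => i.elim0) z

lemma mul_iInf_le_totalCost [Fintype D] (P : Params D) (x : ℕ → D) (t : ℕ) :
    t * (⨅ z, P.c z) ≤ totalCost P x t := by
  rw [totalCost, ← nsmul_eq_mul]
  simpa using Finset.card_nsmul_le_sum (Finset.range t) (fun j => P.c (x j)) _
    fun j _ => iInf_cost_le P (x j)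

/-- The epochs that count towards accuracy `ε` are an initial segment, after which the target
confidence suffices for this accuracy. -/
lemma Admissible.exists_epochsBefore_eq (hP : Admissible P) {ε : ℝ} (hε : 0 < ε) :
    ∃ N, 1 ≤ N ∧ epochsBefore P ε = Finset.Icc 1 N ∧ 4 * (1 + P.δbar) * P.η N ≤ ε := by
  have hδ := hP.δbar_pos
  have hex : ∃ N, 1 ≤ N ∧ 4 * (1 + P.δbar) * P.η N ≤ ε := by
    obtain ⟨N, hN, hlt⟩ := hP.exists_η_lt (a := ε / (4 * (1 + P.δbar))) (by positivity) 1
    rw [lt_div_iff₀' (by positivity)] at hlt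
    exact ⟨N, hN, hlt.le⟩
  classical
  obtain ⟨hN1, hN⟩ := Nat.find_spec hex
  refine ⟨Nat.find hex, hN1, ?_, hN⟩
  ext i
  simp only [epochsBefore, Set.mem_ofPred_eq, Finset.coe_Icc, Set.mem_Icc]
  refine and_congr_right fun hi => ⟨?_, fun hle => ?_⟩
  · rintro (rfl | hlt)
    · exact hN1
    · by_contra! hcon
      refine hlt.not_ge (le_trans ?_ hN)
      have := hP.η_anti (i := Nat.find hex) (j := i - 1) (by omega)
      gcongr
  · rcases hi.eq_or_lt with h1 | h1
    · exact Or.inl h1.symm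
    · right
      have := Nat.find_min hex (m := i - 1) (by omega)
      push Not at this
      exact this (by omega)

end Sequence

/-! ### One update of the state -/

section Update

variable {D : Type*} [Fintype D] [DecidableEq D] {P : Params D} {f : D → ℝ}

lemma le_nextEpoch (P : Params D) {n : ℕ} (p : Fin n → D) (M : Finset D) (i : ℕ) :
    i ≤ nextEpoch P p M i := by
  unfold nextEpoch
  split_ifs with h
  · exact (Nat.find_spec h).1
  · exact le_rfl

lemma nextEpoch_empty (P : Params D) {n : ℕ} (p : Fin n → D) (i : ℕ) :
    nextEpoch P p ∅ i = i := by
  simp [nextEpoch]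

lemma mul_postSd_le_of_lt_nextEpoch {n : ℕ} {p : Fin n → D} {M : Finset D} {i j : ℕ} (hij : i ≤ j)
    (hj : j < nextEpoch P p M i) {x : D} (hx : x ∈ M) :
    √(P.β j) * postSd P p x ≤ (1 + P.δbar) * P.η j := by
  unfold nextEpoch at hj
  split_ifs at hj with h
  · have := Nat.find_min h hj
    push Not at this
    exact this hij x hx
  · omega

lemma Admissible.exists_lt_of_nextEpoch (hP : Admissible P) {n : ℕ} (p : Fin n → D) {M : Finset D}
    (hM : M.Nonempty) {i : ℕ} (hi : 1 ≤ i) (hβ : 0 < P.β i) :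
    ∃ x ∈ M, (1 + P.δbar) * P.η (nextEpoch P p M i)
      < √(P.β (nextEpoch P p M i)) * postSd P p x := by
  obtain ⟨x, hx⟩ := hM
  have hδ := hP.δbar_pos
  have h : ∃ j, i ≤ j ∧ ¬ ∀ x ∈ M, √(P.β j) * postSd P p x ≤ (1 + P.δbar) * P.η j := by
    have hpos : 0 < √(P.β i) * postSd P p x / (1 + P.δbar) :=
      div_pos (mul_pos (Real.sqrt_pos.mpr hβ) (hP.postSd_pos p x)) (by linarith)
    obtain ⟨j, hij, hj⟩ := hP.exists_η_lt hpos i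
    rw [lt_div_iff₀' (by linarith)] at hj
    refine ⟨j, hij, fun hall => (hall x hx).not_gt (hj.trans_le ?_)⟩
    exact mul_le_mul_of_nonneg_right (Real.sqrt_le_sqrt (hP.β_mono hi hij)) (hP.postSd_pos p x).le
  have hnot : ¬ ∀ x ∈ M, √(P.β (nextEpoch P p M i)) * postSd P p x
      ≤ (1 + P.δbar) * P.η (nextEpoch P p M i) := by
    rw [nextEpoch, dif_pos h]
    exact (@Nat.find_spec _ _ h).2
  push Not at hnot
  exact hnot

lemma update_M_subset (P : Params D) (s : State D) {n : ℕ} (p : Fin n → D) (y : Fin n → ℝ) :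
    (update P s p y).M ⊆ s.M := by
  unfold update
  cases P.task <;> exact Finset.filter_subset _ _

lemma update_epoch (P : Params D) (s : State D) {n : ℕ} (p : Fin n → D) (y : Fin n → ℝ) :
    (update P s p y).epoch = nextEpoch P p (update P s p y).M s.epoch := by
  unfold update
  cases P.task <;> rfl

/-- Once all points are classified, the state does not change any more. -/
lemma update_of_M_eq_empty (P : Params D) {s : State D} (hs : s.M = ∅) {n : ℕ} (p : Fin n → D)
    (y : Fin n → ℝ) : update P s p y = s := by
  obtain ⟨M, H, L, i⟩ := s
  obtain rfl : M = ∅ := hs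
  unfold update
  cases P.task <;> simp [nextEpoch_empty]

/-- The classification of points made so far is correct: no maximizer of `f` has been discarded,
respectively all points are on the side of the threshold which they have been assigned to. -/
def Classified (P : Params D) (f : D → ℝ) (s : State D) : Prop :=
  match P.task with
  | Task.bo => ∀ xs, (∀ z, f z ≤ f xs) → xs ∈ s.M
  | Task.lse h => (∀ x ∈ s.H, h < f x) ∧ ∀ x ∈ s.L, f x < h

lemma Classified.update {s : State D} {n : ℕ} {p : Fin n → D} {y : Fin n → ℝ}
    (hs : Classified P f s) (hb : InBounds P f s.epoch p y) :
    Classified P f (update P s p y) := by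
  unfold Classified TruVaR.update at *
  cases hT : P.task with
  | bo =>
    simp only [hT] at hs ⊢
    intro xs hxs
    exact Finset.mem_filter.mpr
      ⟨hs xs hxs, fun z _ => (hb.lcb_le z).trans ((hxs z).trans (hb.le_ucb xs))⟩
  | lse h =>
    simp only [hT] at hs ⊢
    refine ⟨fun x hx => ?_, fun x hx => ?_⟩
    · rcases Finset.mem_union.mp hx with hx | hx
      · exact hs.1 x hx
      · exact (Finset.mem_filter.mp hx).2.trans_le (hb.lcb_le x)
    · rcases Finset.mem_union.mp hx with hx | hx
      · exact hs.2 x hx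
      · exact (hb.le_ucb x).trans_lt (Finset.mem_filter.mp hx).2

variable [Nonempty D]

/-- If the confidence intervals are narrow on the remaining points, then the values at these
points are close to the maximum, respectively to the threshold. -/
lemma update_M_subset_Mbar {s : State D} {n : ℕ} {p : Fin n → D} {y : Fin n → ℝ}
    (hs : Classified P f s) (hb : InBounds P f s.epoch p y) {j : ℕ}
    (hj : ∀ x ∈ (update P s p y).M, √(P.β s.epoch) * postSd P p x ≤ (1 + P.δbar) * P.η j) :
    (update P s p y).M ⊆ Mbar P f j := by
  rcases eq_or_ne j 0 with rfl | hj0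
  · simp [Mbar]
  have hs' := hs.update hb
  intro x hx
  have hxj := hj x hx
  have hxw := ucb_sub_lcb P s.epoch p y x
  have hxu := hb.le_ucb x
  have hxl := hb.lcb_le x
  unfold Mbar
  rw [if_neg hj0]
  unfold Classified at hs hs'
  unfold TruVaR.update at hx hs' hj
  cases hT : P.task with
  | bo =>
    simp only [hT] at hs hs' hx hj ⊢
    obtain ⟨xs, hxs⟩ := Finite.exists_max f
    have hmax : ⨆ z, f z = f xs :=
      le_antisymm (ciSup_le hxs) (le_ciSup (Set.finite_range f).bddAbove xs)
    have h1 := (Finset.mem_filter.mp hx).2 xs (hs xs hxs)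
    have h2 := hj xs (hs' xs hxs)
    have h3 := ucb_sub_lcb P s.epoch p y xs
    have h4 := hb.le_ucb xs
    refine Finset.mem_filter.mpr ⟨Finset.mem_univ _, ?_⟩
    rw [hmax]
    linarith
  | lse h =>
    simp only [hT] at hx ⊢
    have h1 := (Finset.mem_filter.mp hx).2
    refine Finset.mem_filter.mpr ⟨Finset.mem_univ _, abs_le.mpr ⟨?_, ?_⟩⟩ <;> linarith

end Update

/-! ### The invariant of a run -/

section Run

variable {D : Type*} [Fintype D] {P : Params D} {δ : ℝ} {f : D → ℝ}
  {C : ℕ → ℝ} {x : ℕ → D} {y : ℕ → ℝ}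

/-- What a state with remaining points records about the costs, where `p` are the points queried
so far and `c` is their cost: there is a bound `A` on the cost incurred during the current epoch
such that greedy queries of this cost account for the present excess; and the epoch has not reached
its target, except possibly when it has just begun. -/
def CostBound (P : Params D) (f : D → ℝ) (C : ℕ → ℝ) (s : State D) {n : ℕ} (p : Fin n → D)
    (c : ℝ) : Prop :=
  ∃ A, 0 ≤ A ∧ c ≤ ∑ j ∈ Finset.Ico 1 s.epoch, C j + A ∧
    (A = 0 ∨ ∃ x ∈ s.M, (1 + P.δbar) * P.η s.epoch < √(P.β s.epoch) * postSd P p x) ∧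
    ∀ (m : ℕ) (S : Fin m → D),
      (∀ z ∈ Mbar P f (s.epoch - 1), postSd P S z ≤ P.η s.epoch / √(P.β s.epoch)) →
      excess P s.epoch s.M p * Real.exp (A / ∑ j, P.c (S j))
        ≤ (Mbar P f (s.epoch - 1)).card * P.β s.epoch

/-- The invariant of a run on the event that all confidence bounds hold. -/
structure Invariant (P : Params D) (f : D → ℝ) (C : ℕ → ℝ) (s : State D) {n : ℕ} (p : Fin n → D)
    (c : ℝ) : Prop where
  one_le_epoch : 1 ≤ s.epoch
  classified : Classified P f s
  subset : s.M ⊆ Mbar P f (s.epoch - 1)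
  cost : s.M.Nonempty → CostBound P f C s p c

variable [Nonempty D]

/-- As long as points remain, the budget of the current epoch pays for another query. -/
lemma Invariant.cost_add_le (hP : Admissible P) (hδ : 0 < δ) (hδ' : δ < 1)
    (hC : ValidBudgets P δ f C) {s : State D} {n : ℕ} {p : Fin n → D} {c : ℝ}
    (h : Invariant P f C s p c) (hM : s.M.Nonempty) :
    c + ⨆ z, P.c z ≤ ∑ j ∈ Finset.Icc 1 s.epoch, C j := by
  obtain ⟨A, hA0, hcA, hA, hgreedy⟩ := h.cost hM
  have hi := h.one_le_epoch
  rw [← Finset.Ico_add_one_right_eq_Icc, Finset.sum_Ico_succ_top hi]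
  suffices A + ⨆ z, P.c z ≤ C s.epoch by linarith
  rcases hA with rfl | ⟨z, hz, hlt⟩
  -- the epoch has just begun, and its target may be met already: the first epoch is not checked
  -- before the first query, and the logarithm may then be negative
  · simpa using (hC _ hi).1
  refine le_trans ?_ (hC _ hi).2.1
  gcongr
  have hβ := hC.β_pos hP hδ hδ' hi
  have hη := hP.η_pos s.epoch
  have hδb := hP.δbar_pos
  have hex := hP.lt_excess hβ hz hlt
  have h0 : 0 < P.δbar ^ 2 * P.η s.epoch ^ 2 := by positivity
  set B : ℝ := (Mbar P f (s.epoch - 1)).card * P.β s.epoch with hB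
  -- each covering collection `S` satisfies `A ≤ c(S) * log K`, with `K > 1`
  have key : ∀ (m : ℕ) (S : Fin m → D),
      (∀ z ∈ Mbar P f (s.epoch - 1), postSd P S z ≤ P.η s.epoch / √(P.β s.epoch)) →
      1 < B / (P.δbar ^ 2 * P.η s.epoch ^ 2) ∧
      A ≤ (∑ j, P.c (S j)) * Real.log (B / (P.δbar ^ 2 * P.η s.epoch ^ 2)) := by
    intro m S hS
    have hg := hgreedy m S hS
    have hT : 0 ≤ ∑ j, P.c (S j) := Finset.sum_nonneg fun j _ => (hP.c_pos _).le
    have hlt : P.δbar ^ 2 * P.η s.epoch ^ 2 * Real.exp (A / ∑ j, P.c (S j)) < B :=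
      (mul_lt_mul_of_pos_right hex (Real.exp_pos _)).trans_le hg
    have h1 : 1 ≤ Real.exp (A / ∑ j, P.c (S j)) := Real.one_le_exp (div_nonneg hA0 hT)
    have hexp : Real.exp (A / ∑ j, P.c (S j)) < B / (P.δbar ^ 2 * P.η s.epoch ^ 2) := by
      rwa [lt_div_iff₀' h0]
    refine ⟨h1.trans_lt hexp, ?_⟩
    have hm : 0 < ∑ j, P.c (S j) := by
      cases m with
      | zero =>
        have := excess_eq_zero_of_empty hP.cov hβ (p := p) (M := s.M) (S := S)
          fun z hz => hP.mul_postVar_le hβ (hS z (h.subset hz))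
        linarith
      | succ m => exact Finset.sum_pos (fun j _ => hP.c_pos _) Finset.univ_nonempty
    rw [← div_le_iff₀' hm]
    exact ((Real.lt_log_iff_exp_lt ((Real.exp_pos _).trans hexp)).mpr hexp).le
  have hξ : 0 < P.η s.epoch / √(P.β s.epoch) := div_pos hη (Real.sqrt_pos.mpr hβ)
  obtain ⟨m, S, hS⟩ := exists_postVar_le hP.cov (pow_pos hξ 2)
  have hK := Real.log_pos
    (key m S fun x _ => Real.sqrt_le_iff.mpr ⟨hξ.le, hS x⟩).1
  rw [← div_le_iff₀ hK]
  exact hP.le_minCost hξ fun m S hS => (div_le_iff₀ hK).mpr (key m S hS).2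

variable [DecidableEq D]

lemma invariant_zero (hP : Admissible P) (hδ : 0 < δ) (hδ' : δ < 1) (hC : ValidBudgets P δ f C) :
    Invariant P f C (state P x y 0) (fun j : Fin 0 => x j) (totalCost P x 0) where
  one_le_epoch := le_rfl
  classified := by
    unfold Classified
    cases P.task <;> simp [state]
  subset := by simp [state, Mbar]
  cost := fun _ => by
    refine ⟨0, le_rfl, by simp [state, totalCost], Or.inl rfl, fun m S _ => ?_⟩
    simpa [state, Mbar] using
      excess_le_card_mul hP.cov hP.k_self (hC.β_pos hP hδ hδ' le_rfl).le Finset.univ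
        (fun j : Fin 0 => x j)

/-- The confidence bounds of all times, with the radius that the union bound over all times and
points requires. -/
def ConfidenceBounds (P : Params D) (δ : ℝ) (f : D → ℝ) (x : ℕ → D) (y : ℕ → ℝ) : Prop :=
  ∀ t, 1 ≤ t → ∀ z, |f z - postMean P (fun j : Fin t => x j) (fun j : Fin t => y j) z|
    ≤ √(2 * Real.log ((Fintype.card D : ℝ) * t ^ 2 * Real.pi ^ 2 / (6 * δ)))
      * postSd P (fun j : Fin t => x j) z

lemma Invariant.succ (hP : Admissible P) (hδ : 0 < δ) (hδ' : δ < 1)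
    (hC : ValidBudgets P δ f C) (hrun : IsRun P x y) (hconf : ConfidenceBounds P δ f x y) {t : ℕ}
    (h : Invariant P f C (state P x y t) (fun j : Fin t => x j) (totalCost P x t)) :
    Invariant P f C (state P x y (t + 1)) (fun j : Fin (t + 1) => x j)
      (totalCost P x (t + 1)) := by
  have hsucc : state P x y (t + 1) = update P (state P x y t) (fun j : Fin (t + 1) => x j)
    (fun j : Fin (t + 1) => y j) := rfl
  rcases (state P x y t).M.eq_empty_or_nonempty with hM | hM
  · rw [hsucc, update_of_M_eq_empty P hM]
    exact ⟨h.one_le_epoch, h.classified, h.subset, fun h' => by simp [hM] at h'⟩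
  have hacq := hrun t
  set s := state P x y t
  set s' := state P x y (t + 1)
  have hi := h.one_le_epoch
  have hβ := hC.β_pos hP hδ hδ' hi
  have hcost : totalCost P x (t + 1) = totalCost P x t + P.c (x t) := Finset.sum_range_succ _ _
  have hcost' : totalCost P x (t + 1) ≤ ∑ j ∈ Finset.Icc 1 s.epoch, C j := by
    have := h.cost_add_le hP hδ hδ' hC hM
    have := le_iSup_cost P (x t)
    linarith
  have hb : InBounds P f s.epoch (fun j : Fin (t + 1) => x j) (fun j : Fin (t + 1) => y j) := by
    intro z
    refine (hconf (t + 1) (by omega) z).trans ?_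
    refine mul_le_mul_of_nonneg_right (Real.sqrt_le_sqrt ?_) (Real.sqrt_nonneg _)
    exact hC.two_mul_log_le hP hδ hi (by omega) ((mul_iInf_le_totalCost P x _).trans hcost')
  have hsub : s'.M ⊆ s.M := hsucc ▸ update_M_subset P s _ _
  have hep : s'.epoch = nextEpoch P (fun j : Fin (t + 1) => x j) s'.M s.epoch :=
    hsucc ▸ update_epoch P s _ _
  have hle : s.epoch ≤ s'.epoch := hep ▸ le_nextEpoch P _ _ _
  have hi' : 1 ≤ s'.epoch := hi.trans hle
  have hβ' := hC.β_pos hP hδ hδ' hi'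
  have hMbar : s'.M ⊆ Mbar P f (s'.epoch - 1) := by
    rcases hle.eq_or_lt with he | hlt
    · rw [← he]; exact hsub.trans h.subset
    · rw [hsucc]
      refine update_M_subset_Mbar h.classified hb fun z hz => ?_
      rw [← hsucc] at hz ⊢
      refine le_trans ?_ (mul_postSd_le_of_lt_nextEpoch (i := s.epoch) (j := s'.epoch - 1)
        (by omega) (by rw [← hep]; omega) hz)
      gcongr
      · exact Real.sqrt_nonneg _
      · exact hP.β_mono hi (by omega)
  refine ⟨hi', hsucc ▸ h.classified.update hb, hMbar, fun hM' => ?_⟩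
  have hactive := hP.exists_lt_of_nextEpoch (fun j : Fin (t + 1) => x j) hM' hi hβ
  rw [← hep] at hactive
  rcases hle.eq_or_lt with he | hlt
  · -- the epoch goes on
    obtain ⟨A, hA0, hcA, -, hgreedy⟩ := h.cost hM
    refine ⟨A + P.c (x t), add_nonneg hA0 (hP.c_pos _).le, by rw [← he]; linarith,
      Or.inr hactive, fun m S hS => ?_⟩
    rw [← he] at hS ⊢
    refine le_trans ?_ (hgreedy m S hS)
    have hstep := excess_append_le hP.cov hP.sub hP.c_pos hβ.le s.M (fun j : Fin t => x j)
      (x := x t) hacq S fun z hz => hP.mul_postVar_le hβ (hS z (h.subset hz))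
    rw [append_singleton] at hstep
    rw [add_comm A, add_div, Real.exp_add, ← mul_assoc]
    refine mul_le_mul_of_nonneg_right (le_trans ?_ hstep) (Real.exp_pos _).le
    exact mul_le_mul_of_nonneg_right (excess_mono P _ hsub _) (Real.exp_pos _).le
  · -- a new epoch begins
    refine ⟨0, le_rfl, ?_, Or.inl rfl, fun m S _ => ?_⟩
    · rw [add_zero]
      refine hcost'.trans (hC.sum_mono hP (fun j hj => ?_) fun j hj => (Finset.mem_Ico.mp hj).1)
      rw [Finset.mem_Icc] at hj
      exact Finset.mem_Ico.mpr ⟨hj.1, by omega⟩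
    · rw [zero_div, Real.exp_zero, mul_one]
      refine (excess_le_card_mul hP.cov hP.k_self hβ'.le _ _).trans ?_
      gcongr

lemma invariant (hP : Admissible P) (hδ : 0 < δ) (hδ' : δ < 1)
    (hC : ValidBudgets P δ f C) (hrun : IsRun P x y) (hconf : ConfidenceBounds P δ f x y) (t : ℕ) :
    Invariant P f C (state P x y t) (fun j : Fin t => x j) (totalCost P x t) := by
  induction t with
  | zero => exact invariant_zero hP hδ hδ' hC
  | succ t ih => exact ih.succ hP hδ hδ' hC hrun hconf

/-- The deterministic part of the argument: confidence bounds imply accuracy. -/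
theorem accurate_of_confidenceBounds (hP : Admissible P) (hδ : 0 < δ) (hδ' : δ < 1) {ε : ℝ}
    (hε : 0 < ε) (hC : ValidBudgets P δ f C) (hrun : IsRun P x y)
    (hconf : ConfidenceBounds P δ f x y) {t : ℕ}
    (ht : ∑ᶠ i ∈ epochsBefore P ε, C i ≤ totalCost P x t) :
    Accurate P ε f (state P x y t) := by
  obtain ⟨N, hN1, hN, hNε⟩ := hP.exists_epochsBefore_eq hε
  rw [hN, finsum_mem_coe_finset] at ht
  have h := invariant hP hδ hδ' hC hrun hconf t
  set s := state P x y t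
  have hη : s.M.Nonempty → s.epoch - 1 ≠ 0 ∧ 4 * (1 + P.δbar) * P.η (s.epoch - 1) ≤ ε := by
    intro hM
    have hlt : N < s.epoch := by
      by_contra! hcon
      have h1 := h.cost_add_le hP hδ hδ' hC hM
      have h2 := hC.sum_mono hP (Finset.Icc_subset_Icc_right (a := 1) hcon)
        fun j hj => (Finset.mem_Icc.mp hj).1
      have := hP.iSup_cost_pos
      linarith
    refine ⟨by omega, le_trans ?_ hNε⟩
    have := hP.η_anti (i := N) (j := s.epoch - 1) (by omega)
    have := hP.δbar_pos
    gcongr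
  have hcl := h.classified
  have hsub := h.subset
  unfold Classified at hcl
  unfold Mbar at hsub
  unfold Accurate
  cases hT : P.task with
  | bo =>
    simp only [hT] at hcl hsub ⊢
    refine fun xs hxs => ⟨hcl xs hxs, fun z hz => ?_⟩
    obtain ⟨h1, h2⟩ := hη ⟨z, hz⟩
    rw [if_neg h1] at hsub
    have h3 := (Finset.mem_filter.mp (hsub hz)).2
    have h4 := le_ciSup (Set.finite_range f).bddAbove xs
    linarith
  | lse th =>
    simp only [hT] at hcl hsub ⊢
    refine ⟨hcl.1, hcl.2, fun z hz => ?_⟩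
    obtain ⟨h1, h2⟩ := hη ⟨z, hz⟩
    rw [if_neg h1] at hsub
    have h3 := (Finset.mem_filter.mp (hsub hz)).2
    linarith

end Run

/-! ### The Gaussian tail -/

section Tail

open scoped NNReal ENNReal

lemma gaussianPDF_add_le {v : ℝ≥0} (hv : v ≠ 0) {b x s : ℝ} (hs : s ^ 2 = b ^ 2 * v)
    (hx : 0 ≤ x * s) : gaussianPDF 0 v (x + s)
      ≤ ENNReal.ofReal (Real.exp (-b ^ 2 / 2)) * gaussianPDF 0 v x := by
  have hv' : (0 : ℝ) < v := by positivity
  rw [gaussianPDF, gaussianPDF, ← ENNReal.ofReal_mul (Real.exp_pos _).le, gaussianPDFReal,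
    gaussianPDFReal, mul_left_comm, ← Real.exp_add]
  refine ENNReal.ofReal_le_ofReal (mul_le_mul_of_nonneg_left (Real.exp_le_exp.mpr ?_)
    (by positivity))
  have : -b ^ 2 / 2 + -(x - 0) ^ 2 / (2 * v) = -(s ^ 2 + x ^ 2) / (2 * v) := by
    rw [hs]; field_simp; ring
  rw [this]
  gcongr
  nlinarith

lemma gaussianReal_le_mul_shift {v : ℝ≥0} (hv : v ≠ 0) {b s : ℝ}
    (hs : s ^ 2 = b ^ 2 * v) {T : Set ℝ} (hT : MeasurableSet T)
    (hTs : ∀ x, x + s ∈ T → 0 ≤ x * s) :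
    gaussianReal 0 v T ≤ ENNReal.ofReal (Real.exp (-b ^ 2 / 2))
      * gaussianReal 0 v ((fun x => x + s) ⁻¹' T) := by
  have hmeas : MeasurableSet ((fun x : ℝ => x + s) ⁻¹' T) := measurable_add_const s hT
  rw [gaussianReal_apply _ hv, gaussianReal_apply _ hv,
    ← (measurePreserving_add_right volume s).setLIntegral_comp_preimage hT
      (measurable_gaussianPDF 0 v),
    ← lintegral_const_mul _ (measurable_gaussianPDF 0 v)]
  exact setLIntegral_mono (by fun_prop) fun x hx => gaussianPDF_add_le hv hs (hTs x hx)

/-- The two-sided Gaussian tail bound, with constant `1`: the two tails, shifted to the origin,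
are dominated by the two halves of the distribution. -/
lemma gaussianReal_abs_gt_le (v : ℝ≥0) {b : ℝ} (hb : 0 ≤ b) :
    gaussianReal 0 v {z | b * √v < |z|} ≤ ENNReal.ofReal (Real.exp (-b ^ 2 / 2)) := by
  rcases eq_or_ne v 0 with rfl | hv
  · simp
  set s := b * √(v : ℝ)
  have hs0 : 0 ≤ s := by positivity
  have hs : s ^ 2 = b ^ 2 * v := by rw [mul_pow, Real.sq_sqrt v.coe_nonneg]
  have hpos := gaussianReal_le_mul_shift hv hs (measurableSet_Ioi (a := s))
    fun x hx => mul_nonneg (by simpa using (Set.mem_Ioi.mp hx).le) hs0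
  have hneg := gaussianReal_le_mul_shift (b := b) (s := -s) hv (by rw [neg_sq, hs])
    (measurableSet_Iio (a := -s)) fun x hx => by
      have : x < 0 := by simpa using Set.mem_Iio.mp hx
      nlinarith
  have e1 : (fun x => x + s) ⁻¹' Set.Ioi s = Set.Ioi 0 := by ext; simp
  have e2 : (fun x => x + -s) ⁻¹' Set.Iio (-s) = Set.Iio 0 := by ext; simp
  rw [e1] at hpos
  rw [e2] at hneg
  have hset : {z : ℝ | s < |z|} = Set.Ioi s ∪ Set.Iio (-s) := by
    ext z; simp [lt_abs, lt_neg]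
  calc gaussianReal 0 v {z | s < |z|}
      ≤ gaussianReal 0 v (Set.Ioi s) + gaussianReal 0 v (Set.Iio (-s)) :=
        hset ▸ measure_union_le _ _
    _ ≤ ENNReal.ofReal (Real.exp (-b ^ 2 / 2))
        * (gaussianReal 0 v (Set.Ioi 0) + gaussianReal 0 v (Set.Iio 0)) := by
        rw [mul_add]; exact add_le_add hpos hneg
    _ = ENNReal.ofReal (Real.exp (-b ^ 2 / 2)) * gaussianReal 0 v (Set.Ioi 0 ∪ Set.Iio 0) := by
        rw [measure_union _ measurableSet_Iio]
        exact Set.disjoint_left.mpr fun x hx hx' => lt_asymm (Set.mem_Ioi.mp hx) hx'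
    _ ≤ _ := mul_le_of_le_one_right' prob_le_one

end Tail

/-! ### Observations at fixed points -/

section Fixed

variable {D Ω : Type*} [MeasurableSpace Ω] {μ : Measure Ω}

/-- The observations at the points `p`, without adaptivity. -/
def obs (P : Params D) (f : D → Ω → ℝ) (ζ : ℕ → Ω → ℝ) {t : ℕ} (p : Fin t → D) (i : Fin t)
    (ω : Ω) : ℝ :=
  f (p i) ω + √(P.noise (p i)) * ζ i ω

/-- The prediction error at `z` of the posterior mean given the observations at the points `p`. -/
def err (P : Params D) (f : D → Ω → ℝ) (ζ : ℕ → Ω → ℝ) {t : ℕ} (p : Fin t → D) (z : D)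
    (ω : Ω) : ℝ :=
  f z ω - ∑ i, weights P p z i * obs P f ζ p i ω

/-- The reward is a centred Gaussian process with covariance `P.k`, and the normalized noise is
an independent sequence of independent standard Gaussians. -/
structure IsModel (μ : Measure Ω) (P : Params D) (f : D → Ω → ℝ) (ζ : ℕ → Ω → ℝ) : Prop where
  noise_pos : ∀ x, 0 < P.noise x
  measurable_f : ∀ x, Measurable (f x)
  gaussian : IsGaussianProcess f μ
  mean : ∀ x, ∫ ω, f x ω ∂μ = 0
  cov : ∀ x z, cov[f x, f z; μ] = P.k x z
  measurable_ζ : ∀ t, Measurable (ζ t)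
  law_ζ : ∀ t, μ.map (ζ t) = gaussianReal 0 1
  indep_ζ : iIndepFun ζ μ
  indep : IndepFun (fun ω x => f x ω) (fun ω t => ζ t ω) μ

variable {P : Params D} {f : D → Ω → ℝ} {ζ : ℕ → Ω → ℝ}

lemma IsModel.memLp_f (h : IsModel μ P f ζ) (x : D) : MemLp (f x) 2 μ :=
  (h.gaussian.hasGaussianLaw_eval x).memLp_two

lemma IsModel.hasGaussianLaw_ζ (h : IsModel μ P f ζ) (t : ℕ) : HasGaussianLaw (ζ t) μ :=
  ⟨by rw [h.law_ζ]; infer_instance⟩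

lemma IsModel.memLp_ζ (h : IsModel μ P f ζ) (t : ℕ) : MemLp (ζ t) 2 μ :=
  (h.hasGaussianLaw_ζ t).memLp_two

lemma IsModel.measurable_obs (h : IsModel μ P f ζ) {t : ℕ} (p : Fin t → D) (i : Fin t) :
    Measurable (obs P f ζ p i) :=
  (h.measurable_f _).add ((h.measurable_ζ _).const_mul _)

lemma IsModel.measurable_err (h : IsModel μ P f ζ) {t : ℕ} (p : Fin t → D) (z : D) :
    Measurable (err P f ζ p z) :=
  (h.measurable_f _).sub (Finset.measurable_sum _ fun i _ => (h.measurable_obs p i).const_mul _)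

lemma IsModel.cov_f_ζ (h : IsModel μ P f ζ) (x : D) (t : ℕ) : cov[f x, ζ t; μ] = 0 :=
  (h.indep.comp (measurable_pi_apply x) (measurable_pi_apply t)).covariance_eq_zero
    (h.memLp_f x) (h.memLp_ζ t)

lemma IsModel.cov_ζ_ζ (h : IsModel μ P f ζ) (s t : ℕ) :
    cov[ζ s, ζ t; μ] = if s = t then 1 else 0 := by
  split_ifs with hst
  · subst hst
    rw [covariance_self (h.measurable_ζ s).aemeasurable]
    have := variance_id_gaussianReal (μ := 0) (v := 1)
    rw [← h.law_ζ s, variance_map (by fun_prop) (h.measurable_ζ s).aemeasurable] at this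
    simpa using this
  · exact (h.indep_ζ.indepFun hst).covariance_eq_zero (h.memLp_ζ s) (h.memLp_ζ t)

lemma IsModel.memLp_obs (h : IsModel μ P f ζ) {t : ℕ} (p : Fin t → D) (i : Fin t) :
    MemLp (obs P f ζ p i) 2 μ :=
  (h.memLp_f _).add ((h.memLp_ζ _).const_mul _)

lemma IsModel.memLp_err (h : IsModel μ P f ζ) {t : ℕ} (p : Fin t → D) (z : D) :
    MemLp (err P f ζ p z) 2 μ := by
  have hsum : MemLp (fun ω => ∑ i, weights P p z i * obs P f ζ p i ω) 2 μ :=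
    memLp_finsetSum _ fun i _ => (h.memLp_obs p i).const_mul _
  exact (h.memLp_f z).sub hsum

/-- The prediction error and the observations are jointly Gaussian. -/
lemma IsModel.hasGaussianLaw_err_obs [Fintype D] (h : IsModel μ P f ζ) {t : ℕ} (p : Fin t → D)
    (z : D) :
    HasGaussianLaw (fun ω => (fun _ : Unit => err P f ζ p z ω, fun i => obs P f ζ p i ω)) μ := by
  have hf : HasGaussianLaw (fun ω x => f x ω) μ :=
    (h.gaussian.hasGaussianLaw Finset.univ).map_fun
      (ContinuousLinearMap.pi fun x : D => ContinuousLinearMap.proj (R := ℝ)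
        (φ := fun _ : (Finset.univ : Finset D) => ℝ) ⟨x, Finset.mem_univ x⟩)
  have hζ : HasGaussianLaw (fun ω (i : Fin t) => ζ i ω) μ :=
    iIndepFun.hasGaussianLaw (X := fun i : Fin t => ζ i) (fun i => h.hasGaussianLaw_ζ i)
      (h.indep_ζ.precomp Fin.val_injective)
  have hind : IndepFun (fun ω x => f x ω) (fun ω (i : Fin t) => ζ i ω) μ :=
    h.indep.comp measurable_id (measurable_pi_lambda _ fun i : Fin t => measurable_pi_apply (i : ℕ))
  let F : D → ((D → ℝ) × (Fin t → ℝ)) →L[ℝ] ℝ := fun x =>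
    (ContinuousLinearMap.proj x).comp (ContinuousLinearMap.fst ℝ _ _)
  let Z : Fin t → ((D → ℝ) × (Fin t → ℝ)) →L[ℝ] ℝ := fun i =>
    (ContinuousLinearMap.proj i).comp (ContinuousLinearMap.snd ℝ _ _)
  let O : Fin t → ((D → ℝ) × (Fin t → ℝ)) →L[ℝ] ℝ := fun i => F (p i) + √(P.noise (p i)) • Z i
  let L := (ContinuousLinearMap.pi fun _ : Unit => F z - ∑ i, weights P p z i • O i).prod
    (ContinuousLinearMap.pi O)
  refine (congrArg (HasGaussianLaw · μ) ?_).mp ((hind.hasGaussianLaw hf hζ).map_fun L)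
  ext ω <;> simp [L, O, F, Z, err, obs, mul_add]

variable [IsProbabilityMeasure μ]

lemma IsModel.isCovariance (h : IsModel μ P f ζ) : IsCovariance P where
  symm x z := by rw [← h.cov, ← h.cov, covariance_comm]
  psd n p a := by
    have hmem : ∀ i, MemLp (fun ω => a i * f (p i) ω) 2 μ := fun i => (h.memLp_f _).const_mul _
    have h1 := covariance_fun_sum_fun_sum (μ := μ) hmem hmem
    rw [covariance_self (memLp_finsetSum _ fun i _ => hmem i).aemeasurable] at h1
    refine (variance_nonneg (fun ω => ∑ i, a i * f (p i) ω) μ).trans_eq (h1.trans ?_)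
    refine Finset.sum_congr rfl fun i _ => Finset.sum_congr rfl fun j _ => ?_
    rw [covariance_const_mul_left, covariance_const_mul_right, h.cov]
    ring
  noise_pos := h.noise_pos

lemma IsModel.cov_f_obs (h : IsModel μ P f ζ) {t : ℕ} (p : Fin t → D) (z : D) (i : Fin t) :
    cov[f z, obs P f ζ p i; μ] = P.k (p i) z := by
  have : obs P f ζ p i = f (p i) + fun ω => √(P.noise (p i)) * ζ i ω := rfl
  rw [this, covariance_add_right (h.memLp_f _) (h.memLp_f _) ((h.memLp_ζ _).const_mul _),
    covariance_const_mul_right, h.cov, h.cov_f_ζ, mul_zero, add_zero, h.isCovariance.symm]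

lemma IsModel.cov_obs_obs (h : IsModel μ P f ζ) {t : ℕ} (p : Fin t → D) (i j : Fin t) :
    cov[obs P f ζ p i, obs P f ζ p j; μ] = obsCov P p i j := by
  have : obs P f ζ p i = f (p i) + fun ω => √(P.noise (p i)) * ζ i ω := rfl
  rw [this, covariance_add_left (h.memLp_f _) ((h.memLp_ζ _).const_mul _) (h.memLp_obs p j),
    h.cov_f_obs, covariance_const_mul_left]
  have : obs P f ζ p j = f (p j) + fun ω => √(P.noise (p j)) * ζ j ω := rfl
  rw [this, covariance_add_right (h.memLp_ζ _) (h.memLp_f _) ((h.memLp_ζ _).const_mul _),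
    covariance_const_mul_right, h.cov_ζ_ζ, covariance_comm, h.cov_f_ζ, h.isCovariance.symm]
  rcases eq_or_ne i j with rfl | hij
  · have := Real.mul_self_sqrt (h.noise_pos (p i)).le
    simp [obsCov, this]
  · simp [obsCov, hij, Fin.val_inj]

/-- The prediction error is uncorrelated with the observations. -/
lemma IsModel.cov_err_obs (h : IsModel μ P f ζ) {t : ℕ} (p : Fin t → D) (z : D) (j : Fin t) :
    cov[err P f ζ p z, obs P f ζ p j; μ] = 0 := by
  have hmem : ∀ i, MemLp (fun ω => weights P p z i * obs P f ζ p i ω) 2 μ :=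
    fun i => (h.memLp_obs p i).const_mul _
  have hw := congrFun (obsCov_mulVec_weights h.isCovariance p z) j
  have : err P f ζ p z = f z - fun ω => ∑ i, weights P p z i * obs P f ζ p i ω := rfl
  rw [this, covariance_sub_left (h.memLp_f _) (memLp_finsetSum _ fun i _ => hmem i)
    (h.memLp_obs p j), h.cov_f_obs, covariance_fun_sum_left hmem (h.memLp_obs p j), ← hw,
    sub_eq_zero, Matrix.mulVec, dotProduct]
  refine Finset.sum_congr rfl fun i _ => ?_
  rw [covariance_const_mul_left, h.cov_obs_obs, mul_comm]
  exact congrArg (weights P p z i * ·) (congrFun (congrFun (transpose_obsCov h.isCovariance p) i) j)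

lemma IsModel.variance_err (h : IsModel μ P f ζ) {t : ℕ} (p : Fin t → D) (z : D) :
    Var[err P f ζ p z; μ] = postVar P p z := by
  have hmem : ∀ i, MemLp (fun ω => weights P p z i * obs P f ζ p i ω) 2 μ :=
    fun i => (h.memLp_obs p i).const_mul _
  have he : err P f ζ p z = f z - fun ω => ∑ i, weights P p z i * obs P f ζ p i ω := rfl
  rw [← covariance_self (h.measurable_err p z).aemeasurable]
  conv_lhs => arg 2; rw [he]
  rw [covariance_sub_right (h.memLp_err p z) (h.memLp_f _) (memLp_finsetSum _ fun i _ => hmem i),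
    covariance_fun_sum_right hmem (h.memLp_err p z)]
  simp only [covariance_const_mul_right, h.cov_err_obs, mul_zero, Finset.sum_const_zero, sub_zero]
  rw [he, covariance_sub_left (h.memLp_f _) (memLp_finsetSum _ fun i _ => hmem i) (h.memLp_f _),
    covariance_fun_sum_left hmem (h.memLp_f _), h.cov, postVar_eq, dotProduct]
  congr 1
  refine Finset.sum_congr rfl fun i _ => ?_
  rw [covariance_const_mul_left, covariance_comm, h.cov_f_obs]

lemma IsModel.integral_err (h : IsModel μ P f ζ) {t : ℕ} (p : Fin t → D) (z : D) :
    ∫ ω, err P f ζ p z ω ∂μ = 0 := by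
  have hζ : ∀ t, ∫ ω, ζ t ω ∂μ = 0 := fun t => by
    have := integral_id_gaussianReal (μ := 0) (v := 1)
    rwa [← h.law_ζ t, integral_map (h.measurable_ζ t).aemeasurable (by fun_prop)] at this
  have hfi : ∀ x, Integrable (f x) μ := fun x => (h.memLp_f x).integrable one_le_two
  have hζi : ∀ t, Integrable (ζ t) μ := fun t => (h.memLp_ζ t).integrable one_le_two
  have hoi : ∀ i, Integrable (obs P f ζ p i) μ :=
    fun i => (h.memLp_obs p i).integrable one_le_two
  have ho : ∀ i, ∫ ω, obs P f ζ p i ω ∂μ = 0 := fun i => by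
    simp only [obs]
    rw [integral_add (hfi _) ((hζi _).const_mul _), integral_const_mul, h.mean, hζ, mul_zero,
      add_zero]
  have hwi : ∀ i, Integrable (fun ω => weights P p z i * obs P f ζ p i ω) μ :=
    fun i => (hoi i).const_mul _
  simp only [err]
  rw [integral_sub (hfi z) (integrable_finsetSum _ fun i _ => hwi i),
    integral_finsetSum _ fun i _ => hwi i]
  simp [integral_const_mul, ho, h.mean]

lemma indepFun_prodMk_of_indepFun {α β γ : Type*} [MeasurableSpace α] [MeasurableSpace β]
    [MeasurableSpace γ] {S : Ω → α} {W : Ω → β} {Y : Ω → γ} (hS : Measurable S)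
    (hW : Measurable W) (hY : Measurable Y) (h : IndepFun S (fun ω => (W ω, Y ω)) μ)
    (hWY : IndepFun W Y μ) : IndepFun W (fun ω => (S ω, Y ω)) μ := by
  rw [indepFun_iff_map_prod_eq_prod_map_map hW.aemeasurable (hS.prodMk hY).aemeasurable,
    Measure.ext_prod₃_iff]
  intro A B C hA hB hC
  have h1 := h.measure_inter_preimage_eq_mul B (A ×ˢ C) hB (hA.prod hC)
  have h2 := h.measure_inter_preimage_eq_mul B (Set.univ ×ˢ C) hB (MeasurableSet.univ.prod hC)
  have h3 := hWY.measure_inter_preimage_eq_mul A C hA hC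
  rw [Measure.prod_prod, Measure.map_apply (hW.prodMk (hS.prodMk hY)) (hA.prod (hB.prod hC)),
    Measure.map_apply hW hA, Measure.map_apply (hS.prodMk hY) (hB.prod hC)]
  simp only [Set.mk_preimage_prod, Set.preimage_univ, Set.univ_inter] at h1 h2 h3 ⊢
  rw [h2, Set.inter_left_comm, h1, h3, mul_left_comm]

end Fixed

/-! ### Confidence bounds for adaptive queries -/

section Adaptive

open scoped ENNReal

variable {D Ω U : Type*} [Fintype D] [MeasurableSpace Ω] [MeasurableSpace U] {μ : Measure Ω}
  [IsProbabilityMeasure μ] {P : Params D} {f : D → Ω → ℝ} {ζ : ℕ → Ω → ℝ}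

lemma IsModel.indepFun_err_obs (h : IsModel μ P f ζ) {t : ℕ} (p : Fin t → D) (z : D) :
    IndepFun (err P f ζ p z) (fun ω i => obs P f ζ p i ω) μ :=
  ((h.hasGaussianLaw_err_obs p z).indepFun_of_covariance_eval
    fun _ j => h.cov_err_obs p z j).comp (measurable_pi_apply ()) measurable_id

/-- The prediction error is independent of everything that the choice of the queries depends on. -/
lemma IsModel.indepFun_err_seed_obs (h : IsModel μ P f ζ) {seed : Ω → U}
    (hseed : Measurable seed)
    (hind : IndepFun seed (fun ω => ((fun x => f x ω), (fun t => ζ t ω))) μ) {t : ℕ}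
    (p : Fin t → D) (z : D) :
    IndepFun (err P f ζ p z) (fun ω => (seed ω, fun i => obs P f ζ p i ω)) μ := by
  refine indepFun_prodMk_of_indepFun hseed (h.measurable_err p z)
    (measurable_pi_lambda _ fun i => h.measurable_obs p i) ?_ (h.indepFun_err_obs p z)
  refine hind.comp (φ := id) (ψ := fun q : (D → ℝ) × (ℕ → ℝ) =>
    (q.1 z - ∑ i, weights P p z i * (q.1 (p i) + √(P.noise (p i)) * q.2 i),
      fun i : Fin t => q.1 (p i) + √(P.noise (p i)) * q.2 i)) measurable_id ?_
  fun_prop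

lemma IsModel.measure_err_gt_le (h : IsModel μ P f ζ) {t : ℕ} (p : Fin t → D) (z : D) {b : ℝ}
    (hb : 0 ≤ b) : μ {ω | b * postSd P p z < |err P f ζ p z ω|}
      ≤ ENNReal.ofReal (Real.exp (-b ^ 2 / 2)) := by
  have hlaw : HasGaussianLaw (err P f ζ p z) μ := (h.hasGaussianLaw_err_obs p z).fst.eval ()
  have hmap := hlaw.map_eq_gaussianReal
  rw [h.integral_err, h.variance_err] at hmap
  have := gaussianReal_abs_gt_le (postVar P p z).toNNReal hb
  rw [← hmap, Measure.map_apply (h.measurable_err p z)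
    (measurableSet_lt measurable_const (by fun_prop))] at this
  simpa [postSd, Real.coe_toNNReal _ (postVar_nonneg h.isCovariance p z)] using this

/-- The confidence bound at a fixed time and point. The queries are adaptive, but on the event
that the queried points are `p` the observations are those at the fixed points `p`, and this event
depends on them and the seed only, of which the prediction error given `p` is independent. -/
lemma IsModel.measure_confidence_le (h : IsModel μ P f ζ) {seed : Ω → U}
    (hseed : Measurable seed)
    (hind : IndepFun seed (fun ω => ((fun x => f x ω), (fun t => ζ t ω))) μ)
    {x : ℕ → Ω → D} {y : ℕ → Ω → ℝ} {query : (t : ℕ) → U × (Fin t → ℝ) → D}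
    (hquery : ∀ t z, MeasurableSet (query t ⁻¹' {z}))
    (hx : ∀ t ω, x t ω = query t (seed ω, fun j : Fin t => y j ω))
    (hy : ∀ t ω, y t ω = f (x t ω) ω + √(P.noise (x t ω)) * ζ t ω)
    (t : ℕ) (z : D) {b : ℝ} (hb : 0 ≤ b) :
    μ {ω | b * postSd P (fun j : Fin t => x j ω) z
      < |f z ω - postMean P (fun j : Fin t => x j ω) (fun j : Fin t => y j ω) z|}
      ≤ ENNReal.ofReal (Real.exp (-b ^ 2 / 2)) := by
  classical
  -- the data for which the queries are `p`, provided that the observations are those at `p`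
  let G : (Fin t → D) → Set (U × (Fin t → ℝ)) := fun p =>
    {q | ∀ j : Fin t, query j (q.1, fun i : Fin j => q.2 (i.castLE j.2.le)) = p j}
  let A : (Fin t → D) → Set Ω := fun p =>
    (fun ω => (seed ω, fun i => obs P f ζ p i ω)) ⁻¹' G p
  let B : (Fin t → D) → Set Ω := fun p => {ω | b * postSd P p z < |err P f ζ p z ω|}
  have hG : ∀ p, MeasurableSet (G p) := fun p => by
    have : G p = ⋂ j : Fin t, (fun q : U × (Fin t → ℝ) =>
        (q.1, fun i : Fin j => q.2 (i.castLE j.2.le))) ⁻¹' (query j ⁻¹' {p j}) := by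
      ext q; simp [G]
    rw [this]
    refine MeasurableSet.iInter fun j => ?_
    have hm : Measurable fun q : U × (Fin t → ℝ) =>
        (q.1, fun i : Fin j => q.2 (i.castLE j.2.le)) := by fun_prop
    exact hm (hquery j (p j))
  have hA : ∀ p, MeasurableSet (A p) := fun p =>
    (hseed.prodMk (measurable_pi_lambda _ fun i => h.measurable_obs p i)) (hG p)
  have hobs : ∀ {p : Fin t → D} {ω}, (∀ j : Fin t, x j ω = p j) →
      ∀ j : Fin t, y j ω = obs P f ζ p j ω := fun hp j => by rw [hy, obs, hp]
  have hAx : ∀ p ω, ω ∈ A p → ∀ (j : ℕ) (hj : j < t), x j ω = p ⟨j, hj⟩ := by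
    intro p ω hω j
    induction j using Nat.strong_induction_on with
    | _ j ih =>
      intro hj
      have h1 := hω ⟨j, hj⟩
      rw [hx, ← h1]
      congr 2
      funext i
      rw [hy, ih i i.2 (i.2.trans hj)]
      rfl
  have hsub : {ω | b * postSd P (fun j : Fin t => x j ω) z
      < |f z ω - postMean P (fun j : Fin t => x j ω) (fun j : Fin t => y j ω) z|}
      ⊆ ⋃ p, A p ∩ B p := by
    intro ω hω
    have hob := hobs (p := fun j : Fin t => x j ω) (ω := ω) fun j => rfl
    refine Set.mem_iUnion.mpr ⟨fun j : Fin t => x j ω, fun j => ?_, ?_⟩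
    · change query j (seed ω, fun i : Fin j =>
        obs P f ζ (fun j : Fin t => x j ω) (i.castLE j.2.le) ω) = x j ω
      rw [hx]
      congr 2
      funext i
      exact (hob (i.castLE j.2.le)).symm
    · simp only [Set.mem_ofPred_eq, postMean_eq h.isCovariance, dotProduct, hob] at hω
      exact hω
  have hdisj : Pairwise (Function.onFun Disjoint A) := fun p q hpq =>
    Set.disjoint_left.mpr fun ω hp hq => hpq <| funext fun j =>
      (hAx p ω hp j j.2).symm.trans (hAx q ω hq j j.2)
  have hAB : ∀ p, μ (A p ∩ B p) = μ (A p) * μ (B p) := fun p => by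
    rw [Set.inter_comm, mul_comm]
    exact (h.indepFun_err_seed_obs hseed hind p z).measure_inter_preimage_eq_mul
      {w | b * postSd P p z < |w|} (G p) (measurableSet_lt measurable_const (by fun_prop)) (hG p)
  calc _ ≤ μ (⋃ p, A p ∩ B p) := measure_mono hsub
    _ ≤ ∑ p, μ (A p ∩ B p) := measure_iUnion_fintype_le _ _
    _ ≤ ∑ p, μ (A p) * ENNReal.ofReal (Real.exp (-b ^ 2 / 2)) := by
      refine Finset.sum_le_sum fun p _ => ?_
      rw [hAB]
      gcongr
      exact h.measure_err_gt_le p z hb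
    _ = (∑ p, μ (A p)) * ENNReal.ofReal (Real.exp (-b ^ 2 / 2)) := by rw [Finset.sum_mul]
    _ ≤ _ := by
      refine mul_le_of_le_one_left' ((sum_measure_le_measure_univ
        (fun p _ => (hA p).nullMeasurableSet) fun p _ q _ hpq =>
          (hdisj hpq).aedisjoint).trans_eq measure_univ)

/-- All confidence bounds hold with probability at least `1 - δ`: the failure probabilities sum to
at most `δ` because `∑ 1 / t ^ 2 = π ^ 2 / 6`. -/
lemma IsModel.exists_confidenceBounds [Nonempty D] (h : IsModel μ P f ζ) {seed : Ω → U}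
    (hseed : Measurable seed)
    (hind : IndepFun seed (fun ω => ((fun x => f x ω), (fun t => ζ t ω))) μ)
    {x : ℕ → Ω → D} {y : ℕ → Ω → ℝ} {query : (t : ℕ) → U × (Fin t → ℝ) → D}
    (hquery : ∀ t z, MeasurableSet (query t ⁻¹' {z}))
    (hx : ∀ t ω, x t ω = query t (seed ω, fun j : Fin t => y j ω))
    (hy : ∀ t ω, y t ω = f (x t ω) ω + √(P.noise (x t ω)) * ζ t ω)
    {δ : ℝ} (hδ : 0 < δ) (hδ' : δ < 1) :
    ∃ E : Set Ω, MeasurableSet E ∧ ENNReal.ofReal (1 - δ) ≤ μ E ∧ ∀ ω ∈ E,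
      ConfidenceBounds P δ (fun z => f z ω) (fun j => x j ω) (fun j => y j ω) := by
  have hcard : (1 : ℝ) ≤ Fintype.card D := by exact_mod_cast Fintype.card_pos
  have hpi := Real.pi_pos
  let a : ℕ → ℝ := fun t => (Fintype.card D : ℝ) * ((t + 1 : ℕ) : ℝ) ^ 2 * Real.pi ^ 2 / (6 * δ)
  let bad : ℕ → D → Set Ω := fun t z =>
    {ω | √(2 * Real.log (a t)) * postSd P (fun j : Fin (t + 1) => x j ω) z
      < |f z ω - postMean P (fun j : Fin (t + 1) => x j ω) (fun j : Fin (t + 1) => y j ω) z|}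
  have ha : ∀ t, 1 ≤ a t := fun t => by
    have h1 : (1 : ℝ) ≤ ((t + 1 : ℕ) : ℝ) ^ 2 := one_le_pow₀ (by simp)
    have h2 := one_le_mul_of_one_le_of_one_le hcard h1
    rw [one_le_div (by positivity)]
    nlinarith [Real.pi_gt_three]
  have hbad : ∀ t z, μ (bad t z) ≤ ENNReal.ofReal (a t)⁻¹ := fun t z => by
    refine (h.measure_confidence_le hseed hind hquery hx hy (t + 1) z
      (Real.sqrt_nonneg (2 * Real.log (a t)))).trans_eq ?_
    rw [Real.sq_sqrt (mul_nonneg two_pos.le (Real.log_nonneg (ha t))), neg_div,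
      mul_div_cancel_left₀ _ two_ne_zero, Real.exp_neg,
      Real.exp_log (one_pos.trans_le (ha t))]
  have hsum : HasSum (fun t => Fintype.card D * (a t)⁻¹) δ := by
    have h1 := (hasSum_nat_add_iff' (f := fun n : ℕ => (1 : ℝ) / (n : ℝ) ^ 2) 1).mpr hasSum_zeta_two
    simp only [Finset.range_one, Finset.sum_singleton, Nat.cast_zero, ne_eq, OfNat.ofNat_ne_zero,
      not_false_eq_true, zero_pow, div_zero, sub_zero] at h1
    have h2 := h1.mul_left (6 * δ / Real.pi ^ 2)
    have e : 6 * δ / Real.pi ^ 2 * (Real.pi ^ 2 / 6) = δ := by field_simp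
    rw [e] at h2
    have e' : (fun t => Fintype.card D * (a t)⁻¹)
        = fun t => 6 * δ / Real.pi ^ 2 * (1 / ((t + 1 : ℕ) : ℝ) ^ 2) := by
      funext t
      simp only [a]
      field_simp
    rwa [e']
  have hunion : μ (⋃ t, ⋃ z, bad t z) ≤ ENNReal.ofReal δ := by
    calc _ ≤ ∑' t, μ (⋃ z, bad t z) := measure_iUnion_le _
      _ ≤ ∑' t, ENNReal.ofReal (Fintype.card D * (a t)⁻¹) := by
        refine ENNReal.tsum_le_tsum fun t => ?_
        calc _ ≤ ∑ z, μ (bad t z) := measure_iUnion_fintype_le _ _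
          _ ≤ ∑ _z : D, ENNReal.ofReal (a t)⁻¹ := Finset.sum_le_sum fun z _ => hbad t z
          _ = _ := by
            rw [Finset.sum_const, Finset.card_univ, nsmul_eq_mul,
              ENNReal.ofReal_mul (by positivity), ENNReal.ofReal_natCast]
      _ = ENNReal.ofReal δ := by
        rw [← ENNReal.ofReal_tsum_of_nonneg _ hsum.summable, hsum.tsum_eq]
        intro t
        have := one_pos.trans_le (ha t)
        positivity
  -- passing to a measurable superset spares showing that the queries are measurable
  refine ⟨(toMeasurable μ (⋃ t, ⋃ z, bad t z))ᶜ, (measurableSet_toMeasurable _ _).compl, ?_, ?_⟩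
  · rw [prob_compl_eq_one_sub (measurableSet_toMeasurable _ _), measure_toMeasurable,
      ENNReal.ofReal_sub _ hδ.le, ENNReal.ofReal_one]
    exact tsub_le_tsub_left hunion 1
  · intro ω hω t ht z
    obtain ⟨t, rfl⟩ := Nat.exists_eq_add_of_le' ht
    by_contra! hcon
    exact hω (subset_toMeasurable _ _ (Set.mem_iUnion.mpr ⟨t, Set.mem_iUnion.mpr ⟨z, hcon⟩⟩))

end Adaptive

end TruVaR

end

theorem theorem1 {D Ω U : Type*} [Fintype D] [DecidableEq D] [Nonempty D]
    [MeasurableSpace Ω] [MeasurableSpace U] (μ : Measure Ω) [IsProbabilityMeasure μ]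
    (P : TruVaR.Params D) (ε δ : ℝ)
    -- parameters
    (hε : 0 < ε) (hδ : 0 < δ) (hδ' : δ < 1)
    (hδbar : 0 < P.δbar) (hr : 0 < P.r) (hr' : P.r < 1) (hη₁ : 0 < P.η₁)
    (hc : ∀ x, 0 < P.c x) (hnoise : ∀ x, 0 < P.noise x)
    (hβ : ∀ i, 1 ≤ i → P.β i ≤ P.β (i + 1))
    (hk : ∀ x, P.k x x = 1) (hsub : TruVaR.SubmodularVarReduction P)
    -- the reward function: a centred Gaussian process with covariance function `P.k`
    (f : D → Ω → ℝ) (hf : ∀ x, Measurable (f x)) (hfGP : IsGaussianProcess f μ)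
    (hfmean : ∀ x, ∫ ω, f x ω ∂μ = 0) (hfcov : ∀ x z, cov[f x, f z; μ] = P.k x z)
    -- the normalized noise: independent standard Gaussians, independent of the reward function
    (ζ : ℕ → Ω → ℝ) (hζ : ∀ t, Measurable (ζ t)) (hζlaw : ∀ t, μ.map (ζ t) = gaussianReal 0 1)
    (hζind : iIndepFun ζ μ)
    (hfζ : IndepFun (fun ω x => f x ω) (fun ω t => ζ t ω) μ)
    -- an independent source of randomness, for breaking ties
    (seed : Ω → U) (hseed : Measurable seed)
    (hseedind : IndepFun seed (fun ω => ((fun x => f x ω), (fun t => ζ t ω))) μ)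
    -- the queries `x` (depending on past observations only) and the observations `y`
    (x : ℕ → Ω → D) (y : ℕ → Ω → ℝ)
    (query : (t : ℕ) → U × (Fin t → ℝ) → D)
    (hquery : ∀ t z, MeasurableSet (query t ⁻¹' {z}))
    (hx : ∀ t ω, x t ω = query t (seed ω, fun j : Fin t => y j ω))
    (hy : ∀ t ω, y t ω = f (x t ω) ω + Real.sqrt (P.noise (x t ω)) * ζ t ω)
    (hrun : ∀ ω, TruVaR.IsRun P (fun t => x t ω) (fun t => y t ω)) :
    ∃ E : Set Ω, MeasurableSet E ∧ ENNReal.ofReal (1 - δ) ≤ μ E ∧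
      ∀ ω ∈ E, ∀ C : ℕ → ℝ, TruVaR.ValidBudgets P δ (fun z => f z ω) C →
        ∀ t : ℕ, ∑ᶠ i ∈ TruVaR.epochsBefore P ε, C i ≤ ∑ j ∈ Finset.range t, P.c (x j ω) →
          TruVaR.Accurate P ε (fun z => f z ω)
            (TruVaR.state P (fun j => x j ω) (fun j => y j ω) t) := by
  have hM : TruVaR.IsModel μ P f ζ := ⟨hnoise, hf, hfGP, hfmean, hfcov, hζ, hζlaw, hζind, hfζ⟩
  have hP : TruVaR.Admissible P :=
    ⟨hM.isCovariance, hk, hsub, hc, hβ, hδbar, hr, hr', hη₁⟩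
  obtain ⟨E, hE, hμE, hconf⟩ :=
    hM.exists_confidenceBounds hseed hseedind hquery hx hy hδ hδ'
  exact ⟨E, hE, hμE, fun ω hω C hC t ht =>
    TruVaR.accurate_of_confidenceBounds hP hδ hδ' hε hC (hrun ω) (hconf ω hω) ht⟩
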